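/- Let $K$ be a field and let $q\in K$ satisfy $q^k\neq 1$ for all $k\ge 1$. Write $(a;q)_k=\prod_{i=0}^{k-1}(1-aq^i)$ and $\binom{a}{b}_q=\frac{(q;q)_a}{(q;q)_{a-b}(q;q)_b}$. For a partition $\lambda$ let $\ell(\lambda)$ be its number of parts and $m_i(\lambda')$ the number of columns of size $i$ in its Young diagram. A configuration on a rectangular lattice is a labelling of all edges by non-negative integers such that at every vertex, with labels $a$ (bottom), $b$ (left), $c$ (top), $d$ (right), one has $a+b=c+d$; its weight is the product of its vertex weights, and the partition function of the lattice is the sum of the weights of all configurations with the prescribed boundary labels. Let $\mathbf u=(u_i)_{i\ge1}$, $\mathbf v=(v_i)_{i\ge1}$, $\mathbf y=(y_i)_{i\ge1}$ be sequences in $K$. For a partition $\lambda$ and $x_1,\dots,x_n\in K\setminus\{0\}$, let $\mathfrak G^{(\mathbf u,\mathbf v)}_\lambda(x_1,\dots,x_n)$ be the partition function of the lattice with $n$ rows, carrying $x_1,\dots,x_n$ from top to bottom, and with columns numbered $1,2,3,\dots$ from right to left, column $i$ carrying $(u_i,v_i)$ and having bottom label $m_i(\lambda')$ (the columns $i>\ell(\lambda)$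 are empty and contribute the factor $1$); all left and top labels are $0$ and the right labels are free. The weight of a vertex in a row carrying $x$ and a column carrying $(u,v)$ is $$\mathbf 1_{a+b=c+d}\;x^{d}\sum_{p=0}^{\min(b,c)}(ux;q)_{c-p}\,(v/x;q)_p\,(v/x)^{b-p}\binom{c+d-p}{c-p}_q\binom{b}{p}_q ,$$ where $0^0=1$. Let $n\ge 1$, let $y_1,\dots,y_n\neq 0$, let $x_1,\dots,x_n\ne 0$, and let $\lambda$ be a partition with $\ell(\lambda)\le n$. Then $$\mathfrak G^{(\mathbf u,\mathbf v)}_\lambda(x_1,\dots,x_n)=\sum_\mu d_{\lambda,\mu}(\mathbf u,\mathbf v,\mathbf y)\,\mathfrak G^{(\mathbf y,\mathbf 0)}_\mu(x_1,\dots,x_n),$$ where the sum is over all partitions $\mu$ and has only finitely many non-zero terms. Here $d_{\lambda,\mu}(\mathbf u,\mathbf v,\mathbf y)$ is the partition function of the $n\times n$ lattice whose rows carry $y_1,\dots,y_n$ from bottom to top and whose columns carry $(u_n,v_n),\dots,(u_1,v_1)$ from left to right, with bottom labels $m_n(\lambda'),\dots,m_1(\lambda')$ from left to right, right labels $m_1(\mu'),\dots,m_n(\mu')$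 from bottom to top, and all left and top labels $0$; the weight of a vertex in a row carrying $y$ and a column carrying $(u,v)$ is $$\mathbf 1_{a+b=c+d}\;y^{a-d}\sum_{p=0}^{\min(b,c)}(uy^{-1};q)_{c-p}\,(vy;q)_p\,(vy)^{b-p}\binom{c+d-p}{c-p}_q\binom{b}{p}_q .$$ -/

import Mathlib

namespace QLattice

/-- The `q`-Pochhammer symbol `(a;q)_k = (1 - a)(1 - a q) ⋯ (1 - a q^(k-1))`. -/
def qPoch {K : Type*} [Field K] (a q : K) (k : ℕ) : K :=
  ∏ i ∈ Finset.range k, (1 - a * q ^ i)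

/-- The `q`-binomial coefficient `(q;q)_a / ((q;q)_(a-b) (q;q)_b)`, used only for `b ≤ a`. -/
def qBinom {K : Type*} [Field K] (q : K) (a b : ℕ) : K :=
  qPoch q q a / (qPoch q q (a - b) * qPoch q q b)

/-- The number `m_i(λ')` of columns of size `i` in the Young diagram of `λ`. -/
def colMult (lam : YoungDiagram) (i : ℕ) : ℕ :=
  lam.transpose.rowLens.count i

/-- A labelling of the edges of a lattice with `r` rows (numbered from bottom to top) and `s`
columns (numbered from left to right). `vert i j` is the label of the edge of column `j` that
enters row `i` from below (`i = 0` is the bottom boundary, `i = r` the top boundary);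
`horiz i j` is the label of the edge of row `i` that enters column `j` from the left
(`j = 0` is the left boundary, `j = s` the right boundary). -/
@[ext]
structure Labelling (r s : ℕ) where
  vert : Fin (r + 1) → Fin s → ℕ
  horiz : Fin r → Fin (s + 1) → ℕ

/-- The configurations with given bottom and left boundary, empty top boundary and right boundary
in the set `right`, i.e. the labellings that satisfy conservation at every vertex and have this
boundary. A fixed right boundary is a singleton, a free one is `Set.univ`. -/
def configs {r s : ℕ} (bottom : Fin s → ℕ) (left : Fin r → ℕ) (right : Set (Fin r → ℕ)) :
    Set (Labelling r s) :=
  {C | (∀ i j, C.vert i.castSucc j + C.horiz i j.castSucc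
          = C.vert i.succ j + C.horiz i j.succ) ∧
    (∀ j, C.vert 0 j = bottom j) ∧ (∀ j, C.vert (Fin.last r) j = 0) ∧
    (∀ i, C.horiz i 0 = left i) ∧ (fun i => C.horiz i (Fin.last s)) ∈ right}

/-- There are only finitely many configurations, so that partition functions are finite sums. -/
theorem configs_finite {r s : ℕ} (bottom : Fin s → ℕ) (left : Fin r → ℕ)
    (right : Set (Fin r → ℕ)) : (configs bottom left right).Finite := by
  classical
  set M := ∑ j, bottom j + ∑ i, left i with hM
  have key : ∀ C ∈ configs bottom left right, ∀ k : ℕ,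
      (∀ (i : Fin (r + 1)) (j : Fin s), (i : ℕ) + j = k → C.vert i j ≤ M * 2 ^ k) ∧
      (∀ (i : Fin r) (j : Fin (s + 1)), (i : ℕ) + j = k → C.horiz i j ≤ M * 2 ^ k) := by
    rintro C ⟨hc, hb, -, hl, -⟩ k
    have hbot : ∀ j, bottom j ≤ M := fun j =>
      (Finset.single_le_sum (fun _ _ => Nat.zero_le _) (Finset.mem_univ j)).trans
        (Nat.le_add_right _ _)
    have hleft : ∀ i, left i ≤ M := fun i =>
      (Finset.single_le_sum (fun _ _ => Nat.zero_le _) (Finset.mem_univ i)).trans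
        (Nat.le_add_left _ _)
    have hone : ∀ k : ℕ, M ≤ M * 2 ^ k := fun k => Nat.le_mul_of_pos_right _ (by positivity)
    induction k with
    | zero =>
      refine ⟨fun i j h => ?_, fun i j h => ?_⟩
      · obtain rfl : i = 0 := Fin.ext (by simp only [Fin.val_zero]; omega)
        rw [hb]; exact (hbot j).trans (hone _)
      · obtain rfl : j = 0 := Fin.ext (by simp only [Fin.val_zero]; omega)
        rw [hl]; exact (hleft i).trans (hone _)
    | succ k ih =>
      refine ⟨fun i j h => ?_, fun i j h => ?_⟩
      · induction i using Fin.cases with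
        | zero => rw [hb]; exact (hbot j).trans (hone _)
        | succ i =>
          have h1 := ih.1 i.castSucc j (by simp at h ⊢; omega)
          have h2 := ih.2 i j.castSucc (by simp at h ⊢; omega)
          have h3 := hc i j
          rw [pow_succ, ← mul_assoc]; omega
      · induction j using Fin.cases with
        | zero => rw [hl]; exact (hleft i).trans (hone _)
        | succ j =>
          have h1 := ih.1 i.castSucc j (by simp at h ⊢; omega)
          have h2 := ih.2 i j.castSucc (by simp at h ⊢; omega)
          have h3 := hc i j
          rw [pow_succ, ← mul_assoc]; omega
  have hinj : Function.Injective fun C : Labelling r s => (C.vert, C.horiz) := by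
    rintro ⟨v, h⟩ ⟨v', h'⟩ e
    simp only [Prod.mk.injEq] at e
    rw [e.1, e.2]
  refine Set.Finite.of_finite_image (f := fun C : Labelling r s => (C.vert, C.horiz)) ?_
    hinj.injOn
  refine (Set.finite_Iic ((fun i j => M * 2 ^ ((i : ℕ) + j), fun i j => M * 2 ^ ((i : ℕ) + j)) :
    (Fin (r + 1) → Fin s → ℕ) × (Fin r → Fin (s + 1) → ℕ))).subset ?_
  rintro _ ⟨C, hC, rfl⟩
  exact ⟨fun i j => (key C hC _).1 i j rfl, fun i j => (key C hC _).2 i j rfl⟩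

/-- The partition function of the lattice: the sum over all configurations of the product of the
vertex weights. `w i j a b c d` is the weight of the vertex in row `i` and column `j` with
bottom, left, top and right labels `a, b, c, d`. -/
noncomputable def partitionFunction {K : Type*} [Field K] {r s : ℕ}
    (w : Fin r → Fin s → ℕ → ℕ → ℕ → ℕ → K)
    (bottom : Fin s → ℕ) (left : Fin r → ℕ) (right : Set (Fin r → ℕ)) : K :=
  ∑ᶠ C ∈ configs bottom left right, ∏ i : Fin r, ∏ j : Fin s,
    w i j (C.vert i.castSucc j) (C.horiz i j.castSucc) (C.vert i.succ j) (C.horiz i j.succ)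

/-- The weight `𝕎_{x;(u,v)}(a,b,c,d)`. The factor `(x/v)^(p-b)` is written `(v/x)^(b-p)`, which
also makes sense for `v = 0`. -/
def weightG {K : Type*} [Field K] (q x u v : K) (a b c d : ℕ) : K :=
  if a + b = c + d then
    x ^ d * ∑ p ∈ Finset.range (min b c + 1),
      qPoch (u * x) q (c - p) * qPoch (v / x) q p * (v / x) ^ (b - p)
        * qBinom q (c + d - p) (c - p) * qBinom q b p
  else 0

/-- The polynomial `𝔊^{(u,v)}_λ(x_1, …, x_n)`, where `x k` stands for `x_{k+1}` and `u i`, `v i`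
(`i ≥ 1`) for `u_i`, `v_i`. The rows carry `x_n, …, x_1` from bottom to top, the columns carry
`…, (u_2,v_2), (u_1,v_1)` from left to right, the bottom labels are `…, m_2(λ'), m_1(λ')`, left
and top boundary are empty and the right boundary is free. Of the infinitely many columns only the
`ℓ(λ)` rightmost ones are kept: no particle enters the others, so all their labels are `0`,
and `weightG q x u v 0 0 0 0 = 1`. -/
noncomputable def polyG {K : Type*} [Field K] (q : K) (u v : ℕ → K) (lam : YoungDiagram) {n : ℕ}
    (x : Fin n → K) : K :=
  partitionFunction (r := n) (s := lam.colLen 0)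
    (fun i j => weightG q (x i.rev) (u (lam.colLen 0 - (j : ℕ))) (v (lam.colLen 0 - (j : ℕ))))
    (fun j => colMult lam (lam.colLen 0 - (j : ℕ))) (fun _ => 0) Set.univ

/-- The weight that enters the expansion coefficients. -/
def weightD {K : Type*} [Field K] (q y u v : K) (a b c d : ℕ) : K :=
  if a + b = c + d then
    y ^ ((a : ℤ) - (d : ℤ)) * ∑ p ∈ Finset.range (min b c + 1),
      qPoch (u * y⁻¹) q (c - p) * qPoch (v * y) q p * (v * y) ^ (b - p)
        * qBinom q (c + d - p) (c - p) * qBinom q b p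
  else 0

/-- The coefficient `d_{λ,μ}(u,v,y)`: the partition function of the `n × n` lattice whose rows
carry `y_1, …, y_n` from bottom to top, whose columns carry `(u_n,v_n), …, (u_1,v_1)` from left to
right, with bottom labels `m_n(λ'), …, m_1(λ')` from left to right, right labels
`m_1(μ'), …, m_n(μ')` from bottom to top, and empty left and top boundary. -/
noncomputable def coeffD {K : Type*} [Field K] (q : K) (u v y : ℕ → K) (n : ℕ)
    (lam mu : YoungDiagram) : K :=
  partitionFunction (r := n) (s := n)
    (fun i j => weightD q (y ((i : ℕ) + 1)) (u (n - (j : ℕ))) (v (n - (j : ℕ))))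
    (fun j => colMult lam (n - (j : ℕ))) (fun _ => 0) {fun i : Fin n => colMult mu ((i : ℕ) + 1)}

end QLattice

namespace QLattice

/-! ### q-binomial identities in homogeneous form -/

section QBinomial

variable {K : Type*} [Field K]

/-! The expansion comes from the Yang-Baxter equation. Three kinds of lines are used: `U`-lines
carrying $(u_j,v_j)$, `Y`-lines carrying $y_i$, and rows carrying $x_k$. The weight of the
coefficient lattice governs crossings of `U` with `Y`; the weight of $\mathfrak G$ governs crossings
of a row with `U`, and, with parameters $(y_i,0)$, with `Y`. `yangBaxter` says that a triple of such
lines may slide past one another, so every row moves through the whole $n\times n$ grid of `U`- and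
`Y`-lines (`gridD_semiconjBy`).

Start with $m_j(\lambda')$ particles on the `U`-lines and none elsewhere, and require all `U`- and
`Y`-lines to end empty. If the rows act before the grid, the grid sees only empty exits and acts
trivially, while the `Y`-columns stand empty on the left and drop out; what remains is $\mathfrak
G^{(u,v)}_\lambda$. If the grid acts first, it distributes the particles over `U` and `Y`, after
which the rows cross `U` and then `Y`. At a vertex with $v=0$ the top label is at least the left
label, so particles left of $n$ such columns cannot leave within $n$ rows (`rows_apply_eq_zero`).
Hence only grid configurations with empty `U`-exits survive. Their `Y`-exits encode $\mu$, their
weights add up to $d_{\lambda,\mu}$, and the rows contribute $\mathfrak G^{(y,0)}_\mu$.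

For the Yang-Baxter equation itself, each crossing factors into a swap, two elementary moves of
particles with q-binomial weights, and a diagonal factor (`crossing_weightM`). The equation then
reduces to `moveOp_star_triangle` and `moveOp_exchange`, both instances of one transformation of
terminating sums, `homPoch_mul_sum`. Lattices are written as products of operators on functions of
the line labels, so that sliding lines becomes algebra in a monoid. -/

theorem qPoch_zero_right (a q : K) : qPoch a q 0 = 1 := by simp [qPoch]

theorem qPoch_succ (a q : K) (k : ℕ) : qPoch a q (k + 1) = qPoch a q k * (1 - a * q ^ k) := by
  simp [qPoch, Finset.prod_range_succ]

theorem qPoch_zero_left (q : K) (k : ℕ) : qPoch 0 q k = 1 := by simp [qPoch]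

theorem qPoch_self_ne_zero {q : K} (hq : ∀ k : ℕ, 0 < k → q ^ k ≠ 1) (k : ℕ) :
    qPoch q q k ≠ 0 := by
  refine Finset.prod_ne_zero_iff.2 fun i _ => ?_
  rw [← pow_succ']
  exact sub_ne_zero.2 (hq (i + 1) (Nat.succ_pos i)).symm

/-- The homogeneous `q`-Pochhammer symbol `(t - s)(t - s q) ⋯ (t - s q^(k-1))`. -/
def homPoch (q t s : K) (k : ℕ) : K :=
  ∏ i ∈ Finset.range k, (t - s * q ^ i)

@[simp]
theorem homPoch_zero (q t s : K) : homPoch q t s 0 = 1 := by simp [homPoch]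

theorem homPoch_succ (q t s : K) (k : ℕ) :
    homPoch q t s (k + 1) = homPoch q t s k * (t - s * q ^ k) := by
  simp [homPoch, Finset.prod_range_succ]

theorem homPoch_succ' (q t s : K) (k : ℕ) :
    homPoch q t s (k + 1) = (t - s) * homPoch q t (s * q) k := by
  simp only [homPoch, Finset.prod_range_succ', pow_zero, mul_one]
  rw [mul_comm]
  congr 1
  exact Finset.prod_congr rfl fun i _ => by ring

theorem homPoch_mul (q c t s : K) (k : ℕ) :
    homPoch q (c * t) (c * s) k = c ^ k * homPoch q t s k := by
  simp only [homPoch]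
  rw [← Finset.card_range k, ← Finset.prod_const, Finset.card_range, ← Finset.prod_mul_distrib]
  exact Finset.prod_congr rfl fun i _ => by ring

theorem homPoch_zero_right (q t : K) (k : ℕ) : homPoch q t 0 k = t ^ k := by simp [homPoch]

theorem homPoch_one_left (q s : K) (k : ℕ) : homPoch q 1 s k = qPoch s q k := rfl

/-- The `q`-binomial coefficient, extended by `0` to `b > a`. -/
def gaussBinom (q : K) (a b : ℕ) : K :=
  if b ≤ a then qBinom q a b else 0

theorem gaussBinom_of_le (q : K) {a b : ℕ} (h : b ≤ a) : gaussBinom q a b = qBinom q a b :=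
  if_pos h

theorem gaussBinom_of_lt (q : K) {a b : ℕ} (h : a < b) : gaussBinom q a b = 0 :=
  if_neg (by omega)

variable {q : K} (hq : ∀ k : ℕ, 0 < k → q ^ k ≠ 1)
include hq

theorem gaussBinom_zero_right (a : ℕ) : gaussBinom q a 0 = 1 := by
  have := qPoch_self_ne_zero hq a
  simp [gaussBinom, qBinom, qPoch_zero_right, this]

theorem gaussBinom_self (a : ℕ) : gaussBinom q a a = 1 := by
  have := qPoch_self_ne_zero hq a
  simp [gaussBinom, qBinom, qPoch_zero_right, this]

theorem gaussBinom_succ_succ (a b : ℕ) :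
    gaussBinom q (a + 1) (b + 1) = gaussBinom q a (b + 1) + q ^ (a - b) * gaussBinom q a b := by
  rcases lt_trichotomy a b with h | rfl | h
  · rw [gaussBinom_of_lt q (by omega), gaussBinom_of_lt q (by omega), gaussBinom_of_lt q h]
    simp
  · rw [gaussBinom_self hq, gaussBinom_self hq, gaussBinom_of_lt q (by omega)]
    simp
  · obtain ⟨k, rfl⟩ : ∃ k, a = b + 1 + k := ⟨a - (b + 1), by omega⟩
    rw [gaussBinom_of_le q (by omega), gaussBinom_of_le q (by omega), gaussBinom_of_le q (by omega)]
    have e1 : b + 1 + k + 1 - (b + 1) = k + 1 := by omega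
    have e2 : b + 1 + k - (b + 1) = k := by omega
    have e3 : b + 1 + k - b = k + 1 := by omega
    simp only [qBinom, e1, e2, e3]
    have h1 := qPoch_self_ne_zero hq (k + 1)
    have h2 := qPoch_self_ne_zero hq (b + 1)
    rw [qPoch_succ q q (b + 1 + k)]
    rw [qPoch_succ] at h1 h2
    rw [qPoch_succ q q k, qPoch_succ q q b]
    have h3 := left_ne_zero_of_mul h1
    have h4 := right_ne_zero_of_mul h1
    have h5 := left_ne_zero_of_mul h2
    have h6 := right_ne_zero_of_mul h2
    field_simp
    ring

/-- Both products equal the q-multinomial coefficient with parts `n`, `i`, `c - n - i`, and both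
vanish when `n + i > c`. -/
theorem gaussBinom_mul_gaussBinom (c n i : ℕ) :
    gaussBinom q c (n + i) * gaussBinom q (n + i) i
      = gaussBinom q c i * gaussBinom q (c - i) n := by
  by_cases h : n + i ≤ c
  · rw [gaussBinom_of_le q h, gaussBinom_of_le q (by omega), gaussBinom_of_le q (by omega),
      gaussBinom_of_le q (by omega)]
    simp only [qBinom, Nat.add_sub_cancel, show c - (n + i) = c - i - n by omega]
    have h1 := qPoch_self_ne_zero hq (n + i)
    have h2 := qPoch_self_ne_zero hq (c - i)
    have h3 := qPoch_self_ne_zero hq n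
    have h4 := qPoch_self_ne_zero hq i
    have h5 := qPoch_self_ne_zero hq (c - i - n)
    field_simp
  · rw [gaussBinom_of_lt q (by omega : c < n + i), zero_mul]
    by_cases h' : i ≤ c
    · rw [gaussBinom_of_lt q (by omega : c - i < n), mul_zero]
    · rw [gaussBinom_of_lt q (by omega : c < i), zero_mul]

/-- One step of the recursion in the upper index for sums weighted by `q`-binomial coefficients
and two homogeneous `q`-Pochhammer symbols. -/
theorem sum_gaussBinom_homPoch_succ (r y u : K) (n : ℕ) (φ : ℕ → K) :
    ∑ i ∈ Finset.range (n + 2),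
        gaussBinom q (n + 1) i * homPoch q y u i * homPoch q r y (n + 1 - i) * φ i
      = ∑ i ∈ Finset.range (n + 1), gaussBinom q n i * homPoch q y u i * homPoch q r y (n - i) *
        ((r - u * q ^ n) * φ i + q ^ (n - i) * (y - u * q ^ i) * (φ (i + 1) - φ i)) := by
  have h1 : ∑ i ∈ Finset.range (n + 2),
        gaussBinom q (n + 1) i * homPoch q y u i * homPoch q r y (n + 1 - i) * φ i
      = ∑ i ∈ Finset.range (n + 2),
          gaussBinom q n i * homPoch q y u i * homPoch q r y (n + 1 - i) * φ i
        + ∑ i ∈ Finset.range (n + 1), q ^ (n - i) * gaussBinom q n i * homPoch q y u (i + 1) *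
          homPoch q r y (n - i) * φ (i + 1) := by
    rw [Finset.sum_range_succ', Finset.sum_range_succ' _ (n + 1)]
    rw [gaussBinom_zero_right hq, gaussBinom_zero_right hq, add_right_comm,
      ← Finset.sum_add_distrib]
    congr 1
    refine Finset.sum_congr rfl fun i hi => ?_
    rw [gaussBinom_succ_succ hq, Nat.add_sub_add_right]
    ring
  rw [h1, Finset.sum_range_succ, gaussBinom_of_lt q (Nat.lt_succ_self n)]
  simp only [zero_mul, add_zero]
  rw [← Finset.sum_add_distrib]
  refine Finset.sum_congr rfl fun i hi => ?_
  have hi' : i ≤ n := Nat.lt_succ_iff.1 (Finset.mem_range.1 hi)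
  rw [show n + 1 - i = n - i + 1 by omega, homPoch_succ, homPoch_succ]
  -- This gives `r - y q^(n-i) = (r - u q^n) - q^(n-i) (y - u q^i)`, which produces the difference
  -- `φ (i + 1) - φ i`.
  have : q ^ n = q ^ (n - i) * q ^ i := by rw [← pow_add]; congr 1; omega
  rw [this]
  ring

/-- A q-Vandermonde sum: for constant `φ` the difference term in the recursion disappears and only
the factor `r - u q^n` is left. -/
theorem sum_gaussBinom_homPoch (r y u : K) (n : ℕ) :
    ∑ i ∈ Finset.range (n + 1), gaussBinom q n i * homPoch q y u i * homPoch q r y (n - i)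
      = homPoch q r u n := by
  induction n with
  | zero => simp [gaussBinom_self hq]
  | succ n ih =>
    have := sum_gaussBinom_homPoch_succ hq r y u n (fun _ => 1)
    simp only [mul_one, sub_self, mul_zero, add_zero] at this
    rw [this, ← Finset.sum_mul, ih, homPoch_succ]

theorem sum_gaussBinom_homPoch' (r y u : K) (n : ℕ) :
    ∑ i ∈ Finset.range (n + 1), gaussBinom q n i * homPoch q r y i * homPoch q y u (n - i)
      = homPoch q r u n := by
  rw [← sum_gaussBinom_homPoch hq r y u n, ← Finset.sum_range_reflect]
  refine Finset.sum_congr rfl fun i hi => ?_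
  have hi' : i ≤ n := Nat.lt_succ_iff.1 (Finset.mem_range.1 hi)
  rw [show n + 1 - 1 - i = n - i by omega, Nat.sub_sub_self hi']
  rw [gaussBinom_of_le q hi', gaussBinom_of_le q (Nat.sub_le n i)]
  simp only [qBinom, Nat.sub_sub_self hi']
  rw [mul_comm (qPoch q q i)]
  ring

/-- The transformation of terminating sums that underlies the Yang-Baxter equation. -/
theorem homPoch_mul_sum (r y : K) (b n : ℕ) : ∀ (j : ℕ) (u : K),
    homPoch q r u j * ∑ i ∈ Finset.range (n + 1),
        gaussBinom q n i * homPoch q y u i * homPoch q r y (n - i) * gaussBinom q (b + i) j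
      = homPoch q r u n * ∑ k ∈ Finset.range (j + 1),
        gaussBinom q b k * gaussBinom q (b - k + n) (j - k) * homPoch q r y k *
          homPoch q y u (j - k) := by
  induction n with
  | zero =>
    intro j u
    simp only [zero_add, Finset.range_one, Finset.sum_singleton, gaussBinom_self hq, homPoch_zero,
      add_zero, one_mul, mul_one, Nat.sub_self]
    -- For `n = 0` the claim is the q-Vandermonde sum multiplied by the q-binomial of `b` over `j`.
    rw [← sum_gaussBinom_homPoch' hq r y u j, Finset.sum_mul]
    refine Finset.sum_congr rfl fun k hk => ?_
    have hk' : k ≤ j := Nat.lt_succ_iff.1 (Finset.mem_range.1 hk)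
    have := gaussBinom_mul_gaussBinom hq b (j - k) k
    rw [Nat.sub_add_cancel hk'] at this
    rw [← this]
    ring
  | succ n ih =>
    intro j u
    -- Pascal's rule turns the difference of q-binomials into one with lower index `j`, and the
    -- factor `y - u q^i` shifts `u` to `u q`. The induction therefore needs all `j` and `u`; both
    -- sides satisfy the same recursion.
    rw [sum_gaussBinom_homPoch_succ hq]
    cases j with
    | zero =>
      have := sum_gaussBinom_homPoch hq r y u n
      simp only [gaussBinom_zero_right hq, sub_self, mul_zero, add_zero, mul_one, zero_add,
        Finset.range_one, Finset.sum_singleton, homPoch_zero, Nat.sub_self]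
      rw [← Finset.sum_mul, this, homPoch_succ, one_mul]
    | succ j =>
      have e1 : ∑ i ∈ Finset.range (n + 1), gaussBinom q n i * homPoch q y u i *
            homPoch q r y (n - i) * ((r - u * q ^ n) * gaussBinom q (b + i) (j + 1) +
              q ^ (n - i) * (y - u * q ^ i) *
                (gaussBinom q (b + (i + 1)) (j + 1) - gaussBinom q (b + i) (j + 1)))
          = (r - u * q ^ n) * (∑ i ∈ Finset.range (n + 1), gaussBinom q n i * homPoch q y u i *
              homPoch q r y (n - i) * gaussBinom q (b + i) (j + 1))
            + q ^ (n + b - j) * (y - u) * ∑ i ∈ Finset.range (n + 1), gaussBinom q n i *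
              homPoch q y (u * q) i * homPoch q r y (n - i) * gaussBinom q (b + i) j := by
        rw [Finset.mul_sum, Finset.mul_sum, ← Finset.sum_add_distrib]
        refine Finset.sum_congr rfl fun i hi => ?_
        have hi' : i ≤ n := Nat.lt_succ_iff.1 (Finset.mem_range.1 hi)
        rw [← add_assoc b i 1, gaussBinom_succ_succ hq, add_sub_cancel_left]
        -- The total exponent does not depend on `i`; where the subtraction truncates, the
        -- q-binomial is zero.
        have h1 : q ^ (n - i) * (q ^ (b + i - j) * gaussBinom q (b + i) j)
            = q ^ (n + b - j) * gaussBinom q (b + i) j := by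
          by_cases h : j ≤ b + i
          · rw [← mul_assoc, ← pow_add]
            congr 2
            omega
          · rw [gaussBinom_of_lt q (by omega)]
            simp
        have h2 : homPoch q y u i * (y - u * q ^ i) = (y - u) * homPoch q y (u * q) i := by
          rw [← homPoch_succ, homPoch_succ']
        linear_combination (gaussBinom q n i * homPoch q y u i *
            homPoch q r y (n - i) * (y - u * q ^ i)) * h1 +
          (gaussBinom q n i * homPoch q r y (n - i) *
            (q ^ (n + b - j) * gaussBinom q (b + i) j)) * h2
      have e2 : ∑ k ∈ Finset.range (j + 1 + 1), gaussBinom q b k *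
            gaussBinom q (b - k + (n + 1)) (j + 1 - k) * homPoch q r y k *
              homPoch q y u (j + 1 - k)
          = (∑ k ∈ Finset.range (j + 1 + 1), gaussBinom q b k *
            gaussBinom q (b - k + n) (j + 1 - k) * homPoch q r y k * homPoch q y u (j + 1 - k))
            + q ^ (n + b - j) * (y - u) * ∑ k ∈ Finset.range (j + 1), gaussBinom q b k *
              gaussBinom q (b - k + n) (j - k) * homPoch q r y k *
                homPoch q y (u * q) (j - k) := by
        rw [Finset.sum_range_succ, Finset.sum_range_succ _ (j + 1)]
        simp only [Nat.sub_self, gaussBinom_zero_right hq]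
        rw [add_right_comm, Finset.mul_sum, ← Finset.sum_add_distrib]
        congr 1
        refine Finset.sum_congr rfl fun k hk => ?_
        have hk' : k ≤ j := Nat.lt_succ_iff.1 (Finset.mem_range.1 hk)
        rw [show j + 1 - k = j - k + 1 by omega, ← add_assoc, gaussBinom_succ_succ hq,
          homPoch_succ']
        by_cases h : k ≤ b
        · have h1 : q ^ (b - k + n - (j - k)) * gaussBinom q (b - k + n) (j - k)
              = q ^ (n + b - j) * gaussBinom q (b - k + n) (j - k) := by
            congr 2
            omega
          linear_combination (gaussBinom q b k * homPoch q r y k *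
            ((y - u) * homPoch q y (u * q) (j - k))) * h1
        · rw [gaussBinom_of_lt q (by omega : b < k)]
          simp
      rw [e1, e2, mul_add, mul_add, mul_left_comm, ih (j + 1) u, homPoch_succ' q r u j]
      have h3 := ih j (u * q)
      have h4 : (r - u) * homPoch q r (u * q) n = homPoch q r u (n + 1) := (homPoch_succ' ..).symm
      rw [← h4]
      have h5 : homPoch q r u n * (r - u * q ^ n) = (r - u) * homPoch q r (u * q) n := by
        rw [h4, homPoch_succ]
      linear_combination (q ^ (n + b - j) * (y - u) * (r - u)) * h3 +
        (∑ k ∈ Finset.range (j + 1 + 1), gaussBinom q b k *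
            gaussBinom q (b - k + n) (j + 1 - k) * homPoch q r y k *
              homPoch q y u (j + 1 - k)) * h5

end QBinomial


/-! ### Reindexing of finite sums -/

section SumLemmas

variable {M : Type*} [AddCommMonoid M]

theorem sum_range_eq_of_zero {m n : ℕ} (f : ℕ → M) (h : m ≤ n) (hz : ∀ i, m ≤ i → i < n → f i = 0) :
    ∑ i ∈ Finset.range n, f i = ∑ i ∈ Finset.range m, f i :=
  (Finset.sum_subset (Finset.range_mono h) fun i hn hi =>
    hz i (by simpa using hi) (Finset.mem_range.1 hn)).symm

theorem sum_triangle (N : ℕ) (f : ℕ → ℕ → M) :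
    ∑ i ∈ Finset.range (N + 1), ∑ k ∈ Finset.range (N - i + 1), f i k
      = ∑ n ∈ Finset.range (N + 1), ∑ i ∈ Finset.range (n + 1), f i (n - i) := by
  rw [Finset.sum_range_diag_flip]
  refine Finset.sum_congr rfl fun i hi => ?_
  rw [show N + 1 - i = N - i + 1 by have := Finset.mem_range.1 hi; omega]

theorem sum_triangle_comm (N : ℕ) (f : ℕ → ℕ → M) :
    ∑ i ∈ Finset.range (N + 1), ∑ k ∈ Finset.range (N - i + 1), f i k
      = ∑ k ∈ Finset.range (N + 1), ∑ i ∈ Finset.range (N - k + 1), f i k := by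
  refine Finset.sum_comm' fun i k => ?_
  simp only [Finset.mem_range]
  omega

end SumLemmas

/-! ### Operators on functions of the line labels -/

section Operators

variable {K : Type*} [Field K] {ι : Type*}

/-- Multiplication by a function. -/
def mulOp (Φ : (ι → ℕ) → K) : Module.End K ((ι → ℕ) → K) where
  toFun f σ := Φ σ * f σ
  map_add' f g := by
    funext σ
    simp [mul_add]
  map_smul' c f := by
    funext σ
    simp [mul_left_comm]

theorem mulOp_apply (Φ : (ι → ℕ) → K) (f : (ι → ℕ) → K) (σ : ι → ℕ) :
    mulOp Φ f σ = Φ σ * f σ := rfl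

/-- Relabelling of the lines by a permutation. -/
def permOp (K : Type*) [Field K] {ι : Type*} (e : Equiv.Perm ι) :
    Module.End K ((ι → ℕ) → K) where
  toFun f σ := f (σ ∘ e)
  map_add' _ _ := rfl
  map_smul' _ _ := rfl

theorem permOp_apply (e : Equiv.Perm ι) (f : (ι → ℕ) → K) (σ : ι → ℕ) :
    permOp K e f σ = f (σ ∘ e) := rfl

theorem mulOp_comm (Φ Ψ : (ι → ℕ) → K) : Commute (mulOp Φ) (mulOp Ψ) := by
  refine LinearMap.ext fun f => funext fun σ => ?_
  simp only [Module.End.mul_apply, mulOp_apply]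
  ring

theorem mulOp_permOp (φ : ℕ → K) (i : ι) (e : Equiv.Perm ι) :
    mulOp (fun σ => φ (σ i)) * permOp K e
      = permOp K e * mulOp (fun σ => φ (σ (e.symm i))) := by
  refine LinearMap.ext fun f => funext fun σ => ?_
  simp [Module.End.mul_apply, mulOp_apply, permOp_apply]

theorem mulOp_mul_permOp_mul (φ : ℕ → K) (i : ι) (e : Equiv.Perm ι)
    (T : Module.End K ((ι → ℕ) → K)) :
    mulOp (fun σ => φ (σ i)) * (permOp K e * T)
      = permOp K e * (mulOp (fun σ => φ (σ (e.symm i))) * T) := by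
  rw [← mul_assoc, mulOp_permOp, mul_assoc]

theorem permOp_mul (e e' : Equiv.Perm ι) : permOp K e * permOp K e' = permOp K (e * e') := by
  refine LinearMap.ext fun f => funext fun σ => ?_
  simp [Module.End.mul_apply, permOp_apply, Function.comp_assoc]

variable [DecidableEq ι]

/-- Move `k` particles from line `j` to line `i`. -/
def moveState (i j : ι) (k : ℕ) (σ : ι → ℕ) : ι → ℕ :=
  Function.update (Function.update σ j (σ j - k)) i (σ i + k)

/-- Set the labels of the lines `i` and `j`. -/
def setState (i j : ι) (c d : ℕ) (σ : ι → ℕ) : ι → ℕ :=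
  Function.update (Function.update σ i c) j d

/-- The crossing of the vertical line `i` with the horizontal line `j` acting on functions of the
labels of all lines. Products of such operators list the crossings in the order in which particles
pass through them. -/
def crossing (w : ℕ → ℕ → ℕ → ℕ → K) (i j : ι) : Module.End K ((ι → ℕ) → K) where
  toFun f σ := ∑ p ∈ Finset.HasAntidiagonal.antidiagonal (σ i + σ j),
    w (σ i) (σ j) p.1 p.2 * f (setState i j p.1 p.2 σ)
  map_add' f g := by
    funext σ
    simp [mul_add, Finset.sum_add_distrib]
  map_smul' c f := by
    funext σ
    simp only [Pi.smul_apply, smul_eq_mul, RingHom.id_apply, Finset.mul_sum]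
    exact Finset.sum_congr rfl fun p _ => by ring

theorem crossing_apply (w : ℕ → ℕ → ℕ → ℕ → K) (i j : ι) (f : (ι → ℕ) → K) (σ : ι → ℕ) :
    crossing w i j f σ = ∑ p ∈ Finset.HasAntidiagonal.antidiagonal (σ i + σ j),
      w (σ i) (σ j) p.1 p.2 * f (setState i j p.1 p.2 σ) := rfl

/-- Move a `q`-binomially distributed number of particles from line `j` to line `i`, with
additional weight `P k` for `k` particles. -/
def moveOp (q : K) (P : ℕ → K) (i j : ι) : Module.End K ((ι → ℕ) → K) where
  toFun f σ := ∑ k ∈ Finset.range (σ j + 1), gaussBinom q (σ j) k * P k * f (moveState i j k σ)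
  map_add' f g := by
    funext σ
    simp [mul_add, Finset.sum_add_distrib]
  map_smul' c f := by
    funext σ
    simp only [Pi.smul_apply, smul_eq_mul, RingHom.id_apply, Finset.mul_sum]
    exact Finset.sum_congr rfl fun p _ => by ring

theorem moveOp_apply (q : K) (P : ℕ → K) (i j : ι) (f : (ι → ℕ) → K) (σ : ι → ℕ) :
    moveOp q P i j f σ
      = ∑ k ∈ Finset.range (σ j + 1), gaussBinom q (σ j) k * P k * f (moveState i j k σ) := rfl

theorem moveState_left (i j : ι) (k : ℕ) (σ : ι → ℕ) : moveState i j k σ i = σ i + k := by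
  simp [moveState]

theorem moveState_right {i j : ι} (h : i ≠ j) (k : ℕ) (σ : ι → ℕ) :
    moveState i j k σ j = σ j - k := by
  simp [moveState, h.symm]

theorem moveState_of_ne {i j l : ι} (hi : l ≠ i) (hj : l ≠ j) (k : ℕ) (σ : ι → ℕ) :
    moveState i j k σ l = σ l := by
  simp [moveState, hi, hj]

theorem moveOp_mulOp_comm (q : K) (P : ℕ → K) (i j : ι) (Φ : (ι → ℕ) → K)
    (h : ∀ k σ, Φ (moveState i j k σ) = Φ σ) : Commute (moveOp q P i j) (mulOp Φ) := by
  refine LinearMap.ext fun f => funext fun σ => ?_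
  simp only [Module.End.mul_apply, mulOp_apply, moveOp_apply, h, Finset.mul_sum]
  exact Finset.sum_congr rfl fun k _ => by ring

/-- The weight of a move depends on its source only, so moves from different sources into one target
do not interact. -/
theorem moveOp_comm_of_target (q : K) (P Q : ℕ → K) {i j l : ι} (hij : i ≠ j) (hil : i ≠ l)
    (hjl : j ≠ l) : Commute (moveOp q P i j) (moveOp q Q i l) := by
  refine LinearMap.ext fun f => funext fun σ => ?_
  simp only [Module.End.mul_apply, moveOp_apply, moveState_of_ne hil.symm hjl.symm,
    moveState_of_ne hij.symm hjl, Finset.mul_sum]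
  rw [Finset.sum_comm]
  refine Finset.sum_congr rfl fun k _ => Finset.sum_congr rfl fun m _ => ?_
  have : moveState i l k (moveState i j m σ) = moveState i j m (moveState i l k σ) := by
    funext x
    simp only [moveState, Function.update_apply]
    split_ifs <;> simp_all
    omega
  rw [this]
  ring

theorem gaussBinom_symm (q : K) {n k : ℕ} (h : k ≤ n) :
    gaussBinom q n (n - k) = gaussBinom q n k := by
  rw [gaussBinom_of_le q h, gaussBinom_of_le q (Nat.sub_le n k)]
  simp only [qBinom, Nat.sub_sub_self h]
  rw [mul_comm (qPoch q q k)]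

/-- Taking `m` and then `k` particles from one line has a q-multinomial weight, which is symmetric
in the two moves. -/
theorem moveOp_comm_of_source {q : K} (hq : ∀ k : ℕ, 0 < k → q ^ k ≠ 1) (P Q : ℕ → K)
    {i j l : ι} (hij : i ≠ j) (hlj : l ≠ j) (hil : i ≠ l) :
    Commute (moveOp q P i j) (moveOp q Q l j) := by
  refine LinearMap.ext fun f => funext fun σ => ?_
  simp only [Module.End.mul_apply, moveOp_apply, moveState_right hij, moveState_right hlj,
    Finset.mul_sum]
  rw [sum_triangle_comm]
  refine Finset.sum_congr rfl fun k _ => Finset.sum_congr rfl fun m _ => ?_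
  have : moveState l j k (moveState i j m σ) = moveState i j m (moveState l j k σ) := by
    funext x
    simp only [moveState, Function.update_apply]
    split_ifs <;> simp_all
    omega
  rw [this]
  have h1 := gaussBinom_mul_gaussBinom hq (σ j) k m
  have h2 := gaussBinom_mul_gaussBinom hq (σ j) m k
  have h3 : gaussBinom q (k + m) m = gaussBinom q (m + k) k := by
    rw [← gaussBinom_symm q (Nat.le_add_left m k), Nat.add_sub_cancel, add_comm]
  rw [h3, add_comm k m, h2] at h1
  linear_combination (-P m * Q k * f (moveState i j m (moveState l j k σ))) * h1

theorem moveOp_permOp (q : K) (P : ℕ → K) (i j : ι) (e : Equiv.Perm ι) :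
    moveOp q P i j * permOp K e = permOp K e * moveOp q P (e.symm i) (e.symm j) := by
  refine LinearMap.ext fun f => funext fun σ => ?_
  simp only [Module.End.mul_apply, moveOp_apply, permOp_apply, Function.comp_apply,
    Equiv.apply_symm_apply]
  refine Finset.sum_congr rfl fun k _ => ?_
  have : moveState i j k σ ∘ e = moveState (e.symm i) (e.symm j) k (σ ∘ e) := by
    funext x
    simp only [moveState, Function.update_apply, Function.comp_apply, Equiv.apply_symm_apply,
      Equiv.eq_symm_apply]
  rw [this]

theorem moveOp_mul_permOp_mul (q : K) (P : ℕ → K) (i j : ι) (e : Equiv.Perm ι)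
    (T : Module.End K ((ι → ℕ) → K)) :
    moveOp q P i j * (permOp K e * T)
      = permOp K e * (moveOp q P (e.symm i) (e.symm j) * T) := by
  rw [← mul_assoc, moveOp_permOp, mul_assoc]

/-- The star-triangle relation for moves along three lines. -/
theorem moveOp_star_triangle {q : K} (hq : ∀ k : ℕ, 0 < k → q ^ k ≠ 1) (r y u : K) {i j l : ι}
    (hij : i ≠ j) (hil : i ≠ l) (hjl : j ≠ l) :
    moveOp q (homPoch q y u) j l * moveOp q (homPoch q r u) i j * moveOp q (homPoch q r y) j l
      = moveOp q (homPoch q r y) i j * moveOp q (homPoch q r u) j l *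
        moveOp q (homPoch q y u) i j := by
  refine LinearMap.ext fun f => funext fun σ => ?_
  set b := σ j with hb
  set c := σ l with hc
  -- The final state is determined by the total `k` gained by line `i` and the total `n` lost by
  -- line `l`. Both sides are compared coefficient by coefficient in `f (τ k n)`.
  let τ : ℕ → ℕ → ι → ℕ := fun k n =>
    Function.update (Function.update (Function.update σ i (σ i + k)) j (b + n - k)) l (c - n)
  have hL : (moveOp q (homPoch q y u) j l * moveOp q (homPoch q r u) i j *
      moveOp q (homPoch q r y) j l) f σ
      = ∑ k ∈ Finset.range (b + c + 1), ∑ n ∈ Finset.range (c + 1), gaussBinom q c n *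
        f (τ k n) * (homPoch q r u k * ∑ m ∈ Finset.range (n + 1), gaussBinom q n m *
          homPoch q y u m * homPoch q r y (n - m) * gaussBinom q (b + m) k) := by
    have h1 : (moveOp q (homPoch q y u) j l * moveOp q (homPoch q r u) i j *
      moveOp q (homPoch q r y) j l) f σ
      = ∑ m ∈ Finset.range (c + 1), ∑ k ∈ Finset.range (b + c + 1),
        ∑ s ∈ Finset.range (c - m + 1), gaussBinom q c m * homPoch q y u m *
          (gaussBinom q (b + m) k * homPoch q r u k *
            (gaussBinom q (c - m) s * homPoch q r y s * f (τ k (m + s)))) := by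
      simp only [Module.End.mul_apply, moveOp_apply, moveState_left, moveState_right hjl,
        moveState_of_ne hil.symm hjl.symm, ← hb, ← hc]
      refine Finset.sum_congr rfl fun m hm => ?_
      have hm' := Finset.mem_range.1 hm
      rw [sum_range_eq_of_zero (m := b + m + 1) (n := b + c + 1) _ (by omega)
        (fun k hk _ => by rw [gaussBinom_of_lt q (by omega : b + m < k)]; simp), Finset.mul_sum]
      refine Finset.sum_congr rfl fun k hk => ?_
      have hk' := Finset.mem_range.1 hk
      rw [Finset.mul_sum, Finset.mul_sum]
      refine Finset.sum_congr rfl fun s hs => ?_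
      have hs' := Finset.mem_range.1 hs
      congr 4
      funext x
      simp only [moveState, Function.update_apply, τ]
      split_ifs <;> simp_all <;> omega
    rw [h1, Finset.sum_comm]
    refine Finset.sum_congr rfl fun k _ => ?_
    rw [sum_triangle]
    refine Finset.sum_congr rfl fun n _ => ?_
    rw [Finset.mul_sum, Finset.mul_sum]
    refine Finset.sum_congr rfl fun m hm => ?_
    have hm' : m ≤ n := Nat.lt_succ_iff.1 (Finset.mem_range.1 hm)
    have h2 := gaussBinom_mul_gaussBinom hq c (n - m) m
    rw [Nat.sub_add_cancel hm'] at h2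
    rw [Nat.add_sub_cancel' hm']
    linear_combination (-homPoch q y u m * gaussBinom q (b + m) k * homPoch q r u k *
      homPoch q r y (n - m) * f (τ k n)) * h2
  have hR : (moveOp q (homPoch q r y) i j * moveOp q (homPoch q r u) j l *
        moveOp q (homPoch q y u) i j) f σ
      = ∑ k ∈ Finset.range (b + c + 1), ∑ n ∈ Finset.range (c + 1), gaussBinom q c n *
        f (τ k n) * (homPoch q r u n * ∑ m ∈ Finset.range (k + 1),
        gaussBinom q b m * gaussBinom q (b - m + n) (k - m) * homPoch q r y m *
          homPoch q y u (k - m)) := by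
    have h1 : (moveOp q (homPoch q r y) i j * moveOp q (homPoch q r u) j l *
        moveOp q (homPoch q y u) i j) f σ
      = ∑ n ∈ Finset.range (c + 1), ∑ m ∈ Finset.range (b + c + 1),
        ∑ s ∈ Finset.range (b + c - m + 1), gaussBinom q b m * homPoch q r y m *
          (gaussBinom q c n * homPoch q r u n *
            (gaussBinom q (b - m + n) s * homPoch q y u s * f (τ (m + s) n))) := by
      rw [Finset.sum_comm]
      rw [sum_range_eq_of_zero (m := b + 1) (n := b + c + 1) _ (by omega)
        (fun k hk _ => Finset.sum_eq_zero fun n _ => Finset.sum_eq_zero fun s _ => by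
          rw [gaussBinom_of_lt q (by omega : b < k)]; simp)]
      simp only [Module.End.mul_apply, moveOp_apply, moveState_left, moveState_right hij,
        moveState_of_ne hil.symm hjl.symm, ← hb, ← hc]
      refine Finset.sum_congr rfl fun m hm => ?_
      have hm' := Finset.mem_range.1 hm
      rw [Finset.mul_sum]
      refine Finset.sum_congr rfl fun n hn => ?_
      have hn' := Finset.mem_range.1 hn
      rw [sum_range_eq_of_zero (m := b - m + n + 1) (n := b + c - m + 1) _ (by omega)
        (fun k hk _ => by rw [gaussBinom_of_lt q (by omega : b - m + n < k)]; simp),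
        Finset.mul_sum, Finset.mul_sum]
      refine Finset.sum_congr rfl fun s hs => ?_
      have hs' := Finset.mem_range.1 hs
      congr 4
      funext x
      simp only [moveState, Function.update_apply, τ]
      split_ifs <;> simp_all <;> omega
    rw [h1, Finset.sum_comm (s := Finset.range (b + c + 1)) (t := Finset.range (c + 1))]
    refine Finset.sum_congr rfl fun n _ => ?_
    rw [sum_triangle]
    refine Finset.sum_congr rfl fun k _ => ?_
    rw [Finset.mul_sum, Finset.mul_sum]
    refine Finset.sum_congr rfl fun m hm => ?_
    have hm' : m ≤ k := Nat.lt_succ_iff.1 (Finset.mem_range.1 hm)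
    rw [Nat.add_sub_cancel' hm']
    ring
  rw [hL, hR]
  refine Finset.sum_congr rfl fun k _ => Finset.sum_congr rfl fun n _ => ?_
  rw [homPoch_mul_sum hq]

end Operators


/-! ### Factorization of the crossings and the Yang-Baxter equation -/

section YangBaxter

variable {K : Type*} [Field K] {ι : Type*} [DecidableEq ι]

/-- The exchange relation between moves in opposite directions along two lines. -/
theorem moveOp_exchange {q : K} (hq : ∀ k : ℕ, 0 < k → q ^ k ≠ 1) (r y v : K) {i j : ι}
    (hij : i ≠ j) :
    mulOp (fun σ => qPoch (v * y) q (σ j)) * moveOp q (homPoch q v 0) j i *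
        mulOp (fun σ => qPoch (v * r) q (σ i)) * moveOp q (homPoch q r y) i j
      = moveOp q (homPoch q r y) i j * mulOp (fun σ => qPoch (v * r) q (σ j)) *
        moveOp q (homPoch q v 0) j i * mulOp (fun σ => qPoch (v * y) q (σ i)) := by
  refine LinearMap.ext fun f => funext fun σ => ?_
  set a := σ i with ha
  set b := σ j with hb
  let τ : ℕ → ι → ℕ := fun c => setState i j c (a + b - c) σ
  have hL : (mulOp (fun σ => qPoch (v * y) q (σ j)) * moveOp q (homPoch q v 0) j i *
        mulOp (fun σ => qPoch (v * r) q (σ i)) * moveOp q (homPoch q r y) i j) f σ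
      = ∑ c ∈ Finset.range (a + b + 1), f (τ c) * (qPoch (v * y) q b *
        ∑ m ∈ Finset.range (c + 1), gaussBinom q a m * gaussBinom q (a - m + b) (c - m) *
          qPoch (v * r) q m * (v ^ (a - m) * homPoch q r y (c - m))) := by
    have h1 : (mulOp (fun σ => qPoch (v * y) q (σ j)) * moveOp q (homPoch q v 0) j i *
        mulOp (fun σ => qPoch (v * r) q (σ i)) * moveOp q (homPoch q r y) i j) f σ
      = ∑ m ∈ Finset.range (a + b + 1), ∑ k ∈ Finset.range (a + b - m + 1),
        f (τ (m + k)) * (qPoch (v * y) q b * (gaussBinom q a m * gaussBinom q (a - m + b) k *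
          qPoch (v * r) q m * (v ^ (a - m) * homPoch q r y k))) := by
      rw [sum_range_eq_of_zero (m := a + 1) (n := a + b + 1) _ (by omega)
        (fun k hk _ => Finset.sum_eq_zero fun n _ => by
          rw [gaussBinom_of_lt q (by omega : a < k)]; simp)]
      simp only [Module.End.mul_apply, moveOp_apply, mulOp_apply, moveState_left,
        moveState_right hij.symm, ← ha, ← hb, homPoch_zero_right, Finset.mul_sum]
      rw [← Finset.sum_range_reflect]
      refine Finset.sum_congr rfl fun m hm => ?_
      have hm' : m ≤ a := Nat.lt_succ_iff.1 (Finset.mem_range.1 hm)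
      rw [show a + 1 - 1 - m = a - m by omega, Nat.sub_sub_self hm', gaussBinom_symm q hm',
        show b + (a - m) = a + b - m by omega, show a - m + b = a + b - m by omega]
      refine Finset.sum_congr rfl fun k hk => ?_
      have hk' := Finset.mem_range.1 hk
      have : moveState i j k (moveState j i (a - m) σ) = τ (m + k) := by
        funext x
        simp only [moveState, setState, Function.update_apply, τ]
        split_ifs <;> simp_all <;> omega
      rw [this]
      ring
    rw [h1, sum_triangle]
    refine Finset.sum_congr rfl fun c _ => ?_
    rw [Finset.mul_sum, Finset.mul_sum]
    refine Finset.sum_congr rfl fun m hm => ?_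
    rw [Nat.add_sub_cancel' (Nat.lt_succ_iff.1 (Finset.mem_range.1 hm))]
  have hR : (moveOp q (homPoch q r y) i j * mulOp (fun σ => qPoch (v * r) q (σ j)) *
        moveOp q (homPoch q v 0) j i * mulOp (fun σ => qPoch (v * y) q (σ i))) f σ
      = ∑ c ∈ Finset.range (a + b + 1), f (τ c) * (qPoch (v * y) q c *
        ∑ m ∈ Finset.range (b + 1), gaussBinom q b m * homPoch q r y m *
          qPoch (v * r) q (b - m) * (v ^ (a + m - c) * gaussBinom q (a + m) c)) := by
    simp only [Module.End.mul_apply, moveOp_apply, mulOp_apply, moveState_left,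
        moveState_right hij, ← ha, ← hb, homPoch_zero_right]
    simp only [Finset.mul_sum]
    rw [Finset.sum_comm (s := Finset.range (a + b + 1))]
    refine Finset.sum_congr rfl fun m hm => ?_
    have hm' : m ≤ b := Nat.lt_succ_iff.1 (Finset.mem_range.1 hm)
    rw [sum_range_eq_of_zero (m := a + m + 1) (n := a + b + 1) _ (by omega)
        (fun k hk _ => by rw [gaussBinom_of_lt q (by omega : a + m < k)]; simp)]
    rw [← Finset.sum_range_reflect]
    refine Finset.sum_congr rfl fun c hc => ?_
    have hc' : c ≤ a + m := Nat.lt_succ_iff.1 (Finset.mem_range.1 hc)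
    rw [show a + m + 1 - 1 - c = a + m - c by omega, gaussBinom_symm q hc']
    have : moveState j i (a + m - c) (moveState i j m σ) = τ c := by
      funext x
      simp only [moveState, setState, Function.update_apply, τ]
      split_ifs <;> simp_all <;> omega
    have h2 : τ c i = c := by simp [τ, setState, hij]
    rw [this, h2]
    ring
  rw [hL, hR]
  refine Finset.sum_congr rfl fun c _ => ?_
  congr 1
  -- For `v = 0` the powers of `v` leave at most one term in each sum. Otherwise these powers
  -- rescale `homPoch q r y` to parameters `v r`, `v y`, and `homPoch_mul_sum` applies with first
  -- parameter `1`.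
  rcases eq_or_ne v 0 with rfl | hv
  · simp only [zero_mul, qPoch_zero_left, one_mul, mul_one]
    by_cases hac : a ≤ c
    · rw [Finset.sum_eq_single a, Finset.sum_eq_single (c - a)]
      · rw [gaussBinom_self hq, show a + (c - a) = c by omega, gaussBinom_self hq]
        simp [mul_comm]
      · intro m _ hm
        rcases lt_or_gt_of_ne hm with h | h
        · rw [gaussBinom_of_lt q (by omega : a + m < c)]; simp
        · rw [zero_pow (by omega)]; simp
      · intro h
        rw [gaussBinom_of_lt q (by simp at h; omega : b < c - a)]; simp
      · intro m _ hm
        rcases lt_or_gt_of_ne hm with h | h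
        · rw [zero_pow (by omega)]; simp
        · rw [gaussBinom_of_lt q (by omega : a < m)]; simp
      · intro h
        simp at h; omega
    · rw [Finset.sum_eq_zero, Finset.sum_eq_zero]
      · intro m _
        rw [zero_pow (by omega)]; simp
      · intro m hm
        have := Finset.mem_range.1 hm
        rw [zero_pow (by omega)]; simp
  · have key := homPoch_mul_sum hq 1 (v * r) a b c (v * y)
    simp only [homPoch_one_left, homPoch_mul] at key
    have hva : v ^ a ≠ 0 := pow_ne_zero _ hv
    have hvc : v ^ c ≠ 0 := pow_ne_zero _ hv
    have e1 : v ^ c * ∑ m ∈ Finset.range (c + 1), gaussBinom q a m *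
          gaussBinom q (a - m + b) (c - m) * qPoch (v * r) q m *
            (v ^ (a - m) * homPoch q r y (c - m))
        = v ^ a * ∑ k ∈ Finset.range (c + 1), gaussBinom q a k *
          gaussBinom q (a - k + b) (c - k) * qPoch (v * r) q k *
            (v ^ (c - k) * homPoch q r y (c - k)) := by
      rw [Finset.mul_sum, Finset.mul_sum]
      refine Finset.sum_congr rfl fun m hm => ?_
      have hm' : m ≤ c := Nat.lt_succ_iff.1 (Finset.mem_range.1 hm)
      by_cases h : m ≤ a
      · have : v ^ c * v ^ (a - m) = v ^ a * v ^ (c - m) := by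
          rw [← pow_add, ← pow_add]; congr 1; omega
        linear_combination (gaussBinom q a m * gaussBinom q (a - m + b) (c - m) *
          qPoch (v * r) q m * homPoch q r y (c - m)) * this
      · rw [gaussBinom_of_lt q (by omega : a < m)]; simp
    have e2 : v ^ c * ∑ m ∈ Finset.range (b + 1), gaussBinom q b m * homPoch q r y m *
          qPoch (v * r) q (b - m) * (v ^ (a + m - c) * gaussBinom q (a + m) c)
        = v ^ a * ∑ i ∈ Finset.range (b + 1), gaussBinom q b i * (v ^ i * homPoch q r y i) *
          qPoch (v * r) q (b - i) * gaussBinom q (a + i) c := by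
      rw [Finset.mul_sum, Finset.mul_sum]
      refine Finset.sum_congr rfl fun m hm => ?_
      by_cases h : c ≤ a + m
      · have : v ^ c * v ^ (a + m - c) = v ^ a * v ^ m := by
          rw [← pow_add, ← pow_add]; congr 1; omega
        linear_combination (gaussBinom q b m * homPoch q r y m * qPoch (v * r) q (b - m) *
          gaussBinom q (a + m) c) * this
      · rw [gaussBinom_of_lt q (by omega : a + m < c)]; simp
    apply mul_left_cancel₀ hvc
    rw [mul_left_comm, e1, mul_left_comm (v ^ c), e2, mul_left_comm, ← key]
    ring

/-- The vertex weight in the gauge in which it is polynomial in all parameters. -/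
def weightM (q y u v : K) (_a b c d : ℕ) : K :=
  ∑ p ∈ Finset.range (min b c + 1),
    homPoch q y u (c - p) * qPoch (v * y) q p * v ^ (b - p)
      * qBinom q (c + d - p) (c - p) * qBinom q b p

theorem crossing_congr {w w' : ℕ → ℕ → ℕ → ℕ → K} (i j : ι)
    (h : ∀ a b c d, a + b = c + d → w a b c d = w' a b c d) :
    crossing w i j = crossing w' i j := by
  refine LinearMap.ext fun f => funext fun σ => ?_
  simp only [crossing_apply]
  refine Finset.sum_congr rfl fun p hp => ?_
  rw [h _ _ _ _ (Finset.HasAntidiagonal.mem_antidiagonal.1 hp).symm]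

theorem homPoch_eq_pow_mul_qPoch (q u : K) {y : K} (hy : y ≠ 0) (k : ℕ) :
    homPoch q y u k = y ^ k * qPoch (u * y⁻¹) q k := by
  rw [← homPoch_one_left, ← homPoch_mul]
  congr 1
  · ring
  · field_simp

/-- By conservation `(a - d) + (b - p) = c - p`, exactly the power of `y` that makes the
q-Pochhammer symbol homogeneous. -/
theorem weightD_eq_weightM (q u v : K) {y : K} (hy : y ≠ 0) {a b c d : ℕ} (h : a + b = c + d) :
    weightD q y u v a b c d = weightM q y u v a b c d := by
  rw [weightD, if_pos h, weightM, Finset.mul_sum]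
  refine Finset.sum_congr rfl fun p hp => ?_
  have hp' : p ≤ b ∧ p ≤ c := le_min_iff.1 (Nat.lt_succ_iff.1 (Finset.mem_range.1 hp))
  rw [homPoch_eq_pow_mul_qPoch q u hy, mul_pow]
  have : y ^ ((a : ℤ) - d) * y ^ (b - p) = y ^ (c - p) := by
    rw [← zpow_natCast, ← zpow_natCast, ← zpow_add₀ hy]
    congr 1
    omega
  rw [← this]
  ring

/-- By conservation `d - (b - p) = a - (c - p)`. The power `x^(-(c-p))` is absorbed in the
homogeneous symbol, leaving a gauge factor in the bottom label only. -/
theorem weightG_eq_weightM (q u v : K) {x : K} (hx : x ≠ 0) {a b c d : ℕ} (h : a + b = c + d) :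
    weightG q x u v a b c d = x ^ a * weightM q x⁻¹ u v a b c d := by
  rw [weightG, if_pos h, weightM, Finset.mul_sum, Finset.mul_sum]
  refine Finset.sum_congr rfl fun p hp => ?_
  have hp' : p ≤ b ∧ p ≤ c := le_min_iff.1 (Nat.lt_succ_iff.1 (Finset.mem_range.1 hp))
  rw [homPoch_eq_pow_mul_qPoch q u (inv_ne_zero hx), inv_inv, div_eq_mul_inv, mul_pow]
  have : x ^ d * x⁻¹ ^ (b - p) = x ^ a * x⁻¹ ^ (c - p) := by
    rw [inv_pow, inv_pow, ← div_eq_mul_inv, ← div_eq_mul_inv,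
      div_eq_div_iff (pow_ne_zero _ hx) (pow_ne_zero _ hx), ← pow_add, ← pow_add]
    congr 1
    omega
  linear_combination (qPoch (u * x) q (c - p) * qPoch (v * x⁻¹) q p * v ^ (b - p)
      * qBinom q (c + d - p) (c - p) * qBinom q b p) * this

/-- Read the factors from left to right, with `a` on line `i` and `b` on line `j`. After the swap
line `i` holds `b`. All but `p` of these move to line `j`, giving `v^(b-p)`; the diagonal factor
sees the `p` remaining ones; then `c - p` of the `a + b - p` particles on line `j` move to line `i`.
Summing over `p` gives the vertex weight. -/
theorem crossing_weightM (q y u v : K) {i j : ι} (hij : i ≠ j) :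
    crossing (weightM q y u v) i j
      = permOp K (Equiv.swap i j) * moveOp q (homPoch q v 0) j i *
        mulOp (fun σ => qPoch (v * y) q (σ i)) * moveOp q (homPoch q y u) i j := by
  refine LinearMap.ext fun f => funext fun σ => ?_
  simp only [Module.End.mul_apply, moveOp_apply, mulOp_apply, permOp_apply, moveState_left,
    moveState_right hij.symm, Function.comp_apply, Equiv.swap_apply_left, Equiv.swap_apply_right,
    crossing_apply, homPoch_zero_right]
  set a := σ i with ha
  set b := σ j with hb
  rw [Finset.Nat.sum_antidiagonal_eq_sum_range_succ_mk]
  let F : ℕ → ℕ → K := fun p k => homPoch q y u k * qPoch (v * y) q p * v ^ (b - p)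
      * gaussBinom q (a + b - p) k * gaussBinom q b p *
        f (setState i j (p + k) (a + b - (p + k)) σ)
  have hL : ∀ c ∈ Finset.range (a + b).succ,
      weightM q y u v a b c (a + b - c) * f (setState i j c (a + b - c) σ)
        = ∑ p ∈ Finset.range (c + 1), F p (c - p) := by
    intro c hc
    have hc' : c ≤ a + b := Nat.lt_succ_iff.1 (Finset.mem_range.1 hc)
    rw [sum_range_eq_of_zero (m := min b c + 1) (n := c + 1) _ (by omega), weightM,
      Finset.sum_mul]
    · refine Finset.sum_congr rfl fun p hp => ?_
      have hp' : p ≤ b ∧ p ≤ c := le_min_iff.1 (Nat.lt_succ_iff.1 (Finset.mem_range.1 hp))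
      simp only [F]
      rw [Nat.add_sub_cancel' hp'.2, Nat.add_sub_cancel' hc', gaussBinom_of_le q hp'.1,
        gaussBinom_of_le q (by omega)]
    · intro p hp _
      simp only [F]
      by_cases h : p ≤ b
      · rw [gaussBinom_of_lt q (by omega : a + b - p < c - p)]; simp
      · rw [gaussBinom_of_lt q (by omega : b < p)]; simp
  rw [Finset.sum_congr rfl hL, ← sum_triangle]
  rw [sum_range_eq_of_zero (m := b + 1) (n := a + b + 1) _ (by omega)
    (fun p hp _ => Finset.sum_eq_zero fun k _ => by
      simp only [F]; rw [gaussBinom_of_lt q (by omega : b < p)]; simp)]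
  rw [← Finset.sum_range_reflect]
  refine Finset.sum_congr rfl fun k hk => ?_
  have hk' : k ≤ b := Nat.lt_succ_iff.1 (Finset.mem_range.1 hk)
  rw [show b + 1 - 1 - k = b - k by omega, show a + b - (b - k) = a + k by omega,
    Finset.mul_sum, Finset.mul_sum]
  refine Finset.sum_congr rfl fun l hl => ?_
  have hl' : l ≤ a + k := Nat.lt_succ_iff.1 (Finset.mem_range.1 hl)
  simp only [F]
  rw [gaussBinom_symm q hk', show a + b - (b - k) = a + k by omega, Nat.sub_sub_self hk']
  have : moveState i j l (moveState j i k (σ ∘ Equiv.swap i j))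
      = setState i j (b - k + l) (a + b - (b - k + l)) σ := by
    funext x
    simp only [moveState, setState, Function.update_apply, Function.comp_apply]
    split_ifs with h1 h2 h3
    · exact absurd (h1.symm.trans h2) hij
    · simp [hb]
    · simp only [Equiv.swap_apply_right]; omega
    · rw [Equiv.swap_apply_of_ne_of_ne h1 h3]
  rw [this]
  ring

/-- For `v = 0` the first move has weight `0^k` and the diagonal factor is `1`, so both are the
identity. -/
theorem crossing_weightM_zero (q y u : K) {i j : ι} (hij : i ≠ j)
    (hq : ∀ k : ℕ, 0 < k → q ^ k ≠ 1) :
    crossing (weightM q y u 0) i j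
      = permOp K (Equiv.swap i j) * moveOp q (homPoch q y u) i j := by
  rw [crossing_weightM q y u 0 hij]
  have h1 : mulOp (fun σ : ι → ℕ => qPoch (0 * y) q (σ i)) = 1 := by
    refine LinearMap.ext fun f => funext fun σ => ?_
    simp [mulOp_apply, qPoch_zero_left]
  have h2 : moveOp q (homPoch q 0 0) j i = 1 := by
    refine LinearMap.ext fun f => funext fun σ => ?_
    rw [moveOp_apply, Finset.sum_eq_single 0]
    · rw [gaussBinom_zero_right hq]
      simp [moveState]
    · intro k _ hk
      rw [homPoch_zero_right, zero_pow hk]; simp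
    · simp
  rw [h1, h2, mul_one, mul_one]

/-- The Yang-Baxter equation for the polynomial weights. -/
theorem yangBaxter_weightM {q : K} (hq : ∀ k : ℕ, 0 < k → q ^ k ≠ 1) (r y u v : K) {i j l : ι}
    (hij : i ≠ j) (hil : i ≠ l) (hjl : j ≠ l) :
    crossing (weightM q y u v) i j * crossing (weightM q r u v) i l *
        crossing (weightM q r y 0) j l
      = crossing (weightM q r y 0) j l * crossing (weightM q r u v) i l *
        crossing (weightM q y u v) i j := by
  rw [crossing_weightM_zero q r y hjl hq, crossing_weightM q y u v hij,
    crossing_weightM q r u v hil]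
  have hA : permOp K (Equiv.swap i j) * moveOp q (homPoch q v 0) j i *
          mulOp (fun σ => qPoch (v * y) q (σ i)) * moveOp q (homPoch q y u) i j *
        (permOp K (Equiv.swap i l) * moveOp q (homPoch q v 0) l i *
          mulOp (fun σ => qPoch (v * r) q (σ i)) * moveOp q (homPoch q r u) i l) *
        (permOp K (Equiv.swap j l) * moveOp q (homPoch q r y) j l)
      = permOp K (Equiv.swap i j) * permOp K (Equiv.swap i l) * permOp K (Equiv.swap j l) *
        (moveOp q (homPoch q v 0) l j * mulOp (fun σ => qPoch (v * y) q (σ j)) *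
          moveOp q (homPoch q y u) j l * moveOp q (homPoch q v 0) j i *
          mulOp (fun σ => qPoch (v * r) q (σ i)) * moveOp q (homPoch q r u) i j *
          moveOp q (homPoch q r y) j l) := by
    simp only [mul_assoc, moveOp_mul_permOp_mul, mulOp_mul_permOp_mul, Equiv.symm_swap,
      Equiv.swap_apply_left, Equiv.swap_apply_right, Equiv.swap_apply_of_ne_of_ne hij hil,
      Equiv.swap_apply_of_ne_of_ne hij.symm hjl]
  have hB : (permOp K (Equiv.swap j l) * moveOp q (homPoch q r y) j l) *
        (permOp K (Equiv.swap i l) * moveOp q (homPoch q v 0) l i *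
          mulOp (fun σ => qPoch (v * r) q (σ i)) * moveOp q (homPoch q r u) i l) *
        (permOp K (Equiv.swap i j) * moveOp q (homPoch q v 0) j i *
          mulOp (fun σ => qPoch (v * y) q (σ i)) * moveOp q (homPoch q y u) i j)
      = permOp K (Equiv.swap j l) * permOp K (Equiv.swap i l) * permOp K (Equiv.swap i j) *
        (moveOp q (homPoch q r y) i j * moveOp q (homPoch q v 0) l j *
          mulOp (fun σ => qPoch (v * r) q (σ j)) * moveOp q (homPoch q r u) j l *
          moveOp q (homPoch q v 0) j i * mulOp (fun σ => qPoch (v * y) q (σ i)) *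
          moveOp q (homPoch q y u) i j) := by
    simp only [mul_assoc, moveOp_mul_permOp_mul, mulOp_mul_permOp_mul, Equiv.symm_swap,
      Equiv.swap_apply_left, Equiv.swap_apply_right,
      Equiv.swap_apply_of_ne_of_ne hij.symm hjl, Equiv.swap_apply_of_ne_of_ne hil.symm hjl.symm]
  -- The braid relation for transpositions.
  have hperm : permOp K (Equiv.swap i j) * permOp K (Equiv.swap i l) * permOp K (Equiv.swap j l)
      = permOp K (Equiv.swap j l) * permOp K (Equiv.swap i l) * permOp K (Equiv.swap i j) := by
    simp only [permOp_mul]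
    congr 1
    ext x
    simp only [Equiv.Perm.coe_mul, Function.comp_apply, Equiv.swap_apply_def]
    split_ifs <;> simp_all
  rw [hA, hB, hperm]
  congr 1
  have c1 : ∀ P : ℕ → K, Commute (moveOp q P j l)
      (moveOp q (homPoch q v 0) j i) := fun P =>
    moveOp_comm_of_target q P _ hjl hij.symm hil.symm
  have c2 : ∀ (P : ℕ → K) (z : K), Commute (moveOp q P j l)
      (mulOp fun σ => qPoch z q (σ i)) := fun P z =>
    moveOp_mulOp_comm q P j l _ fun k σ => by rw [moveState_of_ne hij hil]
  have c3 : Commute (moveOp q (homPoch q v 0) l j) (moveOp q (homPoch q r y) i j) :=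
    moveOp_comm_of_source hq _ _ hjl.symm hij hil.symm
  have st := moveOp_star_triangle hq r y u hij hil hjl
  have ex := moveOp_exchange hq r y v hij
  have d1 : ∀ (P : ℕ → K) (z : K) T, moveOp q P j l * (moveOp q (homPoch q v 0) j i *
      (mulOp (fun σ => qPoch z q (σ i)) * T)) = moveOp q (homPoch q v 0) j i *
      (mulOp (fun σ => qPoch z q (σ i)) * (moveOp q P j l * T)) := fun P z T => by
    rw [← mul_assoc, (c1 P).eq, mul_assoc, ← mul_assoc (moveOp q P j l), (c2 P z).eq, mul_assoc]
  simp only [mul_assoc] at st ex ⊢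
  -- On the left side `d1` brings together the three moves of the star-triangle relation; on the
  -- right side it carries the move with parameters `r`, `u` to the matching place. After the common
  -- first move from `j` to `l` is split off, the exchange relation remains.
  rw [d1, d1, st, ← mul_assoc (moveOp q (homPoch q r y) i j) (moveOp q (homPoch q v 0) l j),
    ← c3.eq, mul_assoc]
  congr 1
  have := congrArg (· * (moveOp q (homPoch q r u) j l * moveOp q (homPoch q y u) i j)) ex
  simpa only [mul_assoc] using this

end YangBaxter


/-! ### Commutation of crossings and restoration of the gauge -/

section CrossingAlgebra

variable {K : Type*} [Field K] {ι : Type*} [DecidableEq ι]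

theorem setState_of_ne {i j l : ι} (hi : l ≠ i) (hj : l ≠ j) (c d : ℕ) (σ : ι → ℕ) :
    setState i j c d σ l = σ l := by
  simp [setState, hi, hj]

theorem setState_left {i j : ι} (h : i ≠ j) (c d : ℕ) (σ : ι → ℕ) :
    setState i j c d σ i = c := by
  simp [setState, h]

theorem setState_right (i j : ι) (c d : ℕ) (σ : ι → ℕ) : setState i j c d σ j = d := by
  simp [setState]

theorem crossing_mulOp_comm (w : ℕ → ℕ → ℕ → ℕ → K) (i j : ι) (Φ : (ι → ℕ) → K)
    (h : ∀ σ c d, c + d = σ i + σ j → Φ (setState i j c d σ) = Φ σ) :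
    Commute (crossing w i j) (mulOp Φ) := by
  refine LinearMap.ext fun f => funext fun σ => ?_
  simp only [Module.End.mul_apply, mulOp_apply, crossing_apply, Finset.mul_sum]
  refine Finset.sum_congr rfl fun p hp => ?_
  rw [h σ _ _ (Finset.HasAntidiagonal.mem_antidiagonal.1 hp)]
  ring

theorem crossing_comm (w w' : ℕ → ℕ → ℕ → ℕ → K) {i j k l : ι} (hik : i ≠ k) (hil : i ≠ l)
    (hjk : j ≠ k) (hjl : j ≠ l) : Commute (crossing w i j) (crossing w' k l) := by
  refine LinearMap.ext fun f => funext fun σ => ?_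
  simp only [Module.End.mul_apply, crossing_apply, setState_of_ne hik.symm hjk.symm,
    setState_of_ne hil.symm hjl.symm, setState_of_ne hik hil, setState_of_ne hjk hjl,
    Finset.mul_sum]
  rw [Finset.sum_comm]
  refine Finset.sum_congr rfl fun p _ => Finset.sum_congr rfl fun p' _ => ?_
  have : setState k l p.1 p.2 (setState i j p'.1 p'.2 σ)
      = setState i j p'.1 p'.2 (setState k l p.1 p.2 σ) := by
    funext x
    simp only [setState, Function.update_apply]
    split_ifs <;> simp_all
  rw [this]
  ring

theorem crossing_weightG (q u v : K) {x : K} (hx : x ≠ 0) (i j : ι) :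
    crossing (weightG q x u v) i j
      = mulOp (fun σ => x ^ σ i) * crossing (weightM q x⁻¹ u v) i j := by
  refine LinearMap.ext fun f => funext fun σ => ?_
  simp only [Module.End.mul_apply, mulOp_apply, crossing_apply, Finset.mul_sum]
  refine Finset.sum_congr rfl fun p hp => ?_
  rw [weightG_eq_weightM q u v hx (Finset.HasAntidiagonal.mem_antidiagonal.1 hp).symm, mul_assoc]

/-- The Yang-Baxter equation. -/
theorem yangBaxter {q : K} (hq : ∀ k : ℕ, 0 < k → q ^ k ≠ 1) (u v : K) {x y : K} (hx : x ≠ 0)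
    (hy : y ≠ 0) {i j l : ι} (hij : i ≠ j) (hil : i ≠ l) (hjl : j ≠ l) :
    crossing (weightD q y u v) i j * crossing (weightG q x u v) i l *
        crossing (weightG q x y 0) j l
      = crossing (weightG q x y 0) j l * crossing (weightG q x u v) i l *
        crossing (weightD q y u v) i j := by
  rw [crossing_congr i j fun a b c d h => weightD_eq_weightM q u v hy h,
    crossing_weightG q u v hx, crossing_weightG q y 0 hx]
  have h := yangBaxter_weightM hq x⁻¹ y u v hij hil hjl
  set A := crossing (weightM q y u v) i j
  set B := crossing (weightM q x⁻¹ u v) i l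
  set C := crossing (weightM q x⁻¹ y 0) j l
  set X := mulOp (fun σ : ι → ℕ => x ^ σ i)
  set Y := mulOp (fun σ : ι → ℕ => x ^ σ j)
  have h1 : Commute B Y := crossing_mulOp_comm _ _ _ _ fun σ c d _ => by
    rw [setState_of_ne hij.symm hjl]
  have h2 : Commute C X := crossing_mulOp_comm _ _ _ _ fun σ c d _ => by
    rw [setState_of_ne hij hil]
  have h3 : Commute X Y := mulOp_comm _ _
  have h4 : X * Y = mulOp (fun σ : ι → ℕ => x ^ (σ i + σ j)) := by
    refine LinearMap.ext fun f => funext fun σ => ?_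
    simp only [X, Y, Module.End.mul_apply, mulOp_apply, pow_add, mul_assoc]
  have h5 : Commute A (X * Y) := h4 ▸ crossing_mulOp_comm _ _ _ _ fun σ c d hcd => by
    rw [setState_left hij, setState_right, hcd]
  -- `B` does not touch line `j` and `C` does not touch line `i`, while `A` preserves the sum of
  -- their labels. So `X * Y` can be pulled out of the left side and redistributed on the right.
  calc A * (X * B) * (Y * C) = A * X * (B * Y) * C := by simp only [mul_assoc]
    _ = A * (X * Y) * B * C := by rw [h1.eq]; simp only [mul_assoc]
    _ = X * Y * (A * B * C) := by rw [h5.eq]; simp only [mul_assoc]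
    _ = Y * X * C * B * A := by rw [h, h3.eq]; simp only [mul_assoc]
    _ = Y * (C * X) * B * A := by rw [h2.eq]; simp only [mul_assoc]
    _ = Y * C * (X * B) * A := by simp only [mul_assoc]

end CrossingAlgebra

/-! ### Sliding arguments in a monoid -/

section MonoidWords

variable {M : Type*} [Monoid M]

/-- Moves `b`, the crossing of two lines, past a whole family of further lines, one local exchange
at a time. Commuting factors with different indices brings each triple together. -/
theorem prod_mul_prod_mul_of_exchange {α : Type*} (d a : α → M) (b : M) (L : List α)
    (hL : L.Nodup) (h : ∀ j ∈ L, d j * a j * b = b * a j * d j)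
    (hc : ∀ j j', j ≠ j' → Commute (d j) (a j')) :
    (L.map d).prod * (L.map a).prod * b = b * (L.map a).prod * (L.map d).prod := by
  induction L with
  | nil => simp
  | cons j L ih =>
    have hj := (List.nodup_cons.1 hL).1
    have ih' := ih (List.nodup_cons.1 hL).2 fun k hk => h k (List.mem_cons_of_mem j hk)
    have h1 : Commute (L.map d).prod (a j) := by
      refine Commute.list_prod_left _ _ fun z hz => ?_
      obtain ⟨k, hk, rfl⟩ := List.mem_map.1 hz
      exact hc k j fun e => hj (e ▸ hk)
    have h2 : Commute (d j) (L.map a).prod := by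
      refine Commute.list_prod_right _ _ fun z hz => ?_
      obtain ⟨k, hk, rfl⟩ := List.mem_map.1 hz
      exact hc j k fun e => hj (e ▸ hk)
    simp only [List.map_cons, List.prod_cons]
    calc d j * (L.map d).prod * (a j * (L.map a).prod) * b
        = d j * ((L.map d).prod * a j) * (L.map a).prod * b := by simp only [mul_assoc]
      _ = d j * a j * ((L.map d).prod * (L.map a).prod * b) := by
          rw [h1.eq]; simp only [mul_assoc]
      _ = d j * a j * b * (L.map a).prod * (L.map d).prod := by rw [ih']; simp only [mul_assoc]
      _ = b * a j * (d j * (L.map a).prod) * (L.map d).prod := by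
          rw [h j List.mem_cons_self]; simp only [mul_assoc]
      _ = b * (a j * (L.map a).prod) * (d j * (L.map d).prod) := by
          rw [h2.eq]; simp only [mul_assoc]

/-- The second sliding step, with `A` a whole row: the last pair `R`, `b` is innermost and is
exchanged first, which is why the `b` appear in reverse order. -/
theorem prod_mul_mul_reverse_prod_of_exchange {α : Type*} (R b : α → M) (A : M) (L : List α)
    (hL : L.Nodup) (h : ∀ i ∈ L, R i * A * b i = b i * A * R i)
    (hc : ∀ i i', i ≠ i' → Commute (R i) (b i')) :
    (L.map R).prod * A * (L.reverse.map b).prod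
      = (L.reverse.map b).prod * A * (L.map R).prod := by
  induction L with
  | nil => simp
  | cons j L ih =>
    have hj := (List.nodup_cons.1 hL).1
    have ih' := ih (List.nodup_cons.1 hL).2 fun k hk => h k (List.mem_cons_of_mem j hk)
    have h1 : Commute (L.map R).prod (b j) := by
      refine Commute.list_prod_left _ _ fun z hz => ?_
      obtain ⟨k, hk, rfl⟩ := List.mem_map.1 hz
      exact hc k j fun e => hj (e ▸ hk)
    have h2 : Commute (R j) (L.reverse.map b).prod := by
      refine Commute.list_prod_right _ _ fun z hz => ?_
      obtain ⟨k, hk, rfl⟩ := List.mem_map.1 hz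
      exact hc j k fun e => hj (e ▸ List.mem_reverse.1 hk)
    simp only [List.map_cons, List.prod_cons, List.reverse_cons, List.map_append,
      List.prod_append, List.map_nil, List.prod_nil, mul_one]
    set B := (L.reverse.map b).prod
    set Q := (L.map R).prod
    calc R j * Q * A * (B * b j) = R j * (Q * A * B) * b j := by simp only [mul_assoc]
      _ = R j * B * A * (Q * b j) := by rw [ih']; simp only [mul_assoc]
      _ = R j * B * A * b j * Q := by rw [h1.eq]; simp only [mul_assoc]
      _ = B * (R j * A * b j) * Q := by rw [h2.eq]; simp only [mul_assoc]
      _ = B * b j * A * (R j * Q) := by rw [h j List.mem_cons_self]; simp only [mul_assoc]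

theorem semiconjBy_list_prod {α : Type*} (D : M) (a b : α → M) (L : List α)
    (h : ∀ i ∈ L, SemiconjBy D (a i) (b i)) :
    SemiconjBy D (L.map a).prod (L.map b).prod := by
  induction L with
  | nil => simp
  | cons j L ih =>
    simp only [List.map_cons, List.prod_cons]
    exact (h j List.mem_cons_self).mul_right (ih fun k hk => h k (List.mem_cons_of_mem j hk))

end MonoidWords


/-! ### Partition functions as products of crossings -/

section Configurations

/-- The horizontal labels of a single row with bottom labels `a` and left label `b`. -/
def rowCfgs : (s : ℕ) → (Fin s → ℕ) → ℕ → Finset (Fin (s + 1) → ℕ)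
  | 0, _, b => {fun _ => b}
  | s + 1, a, b => (Finset.range (a 0 + b + 1)).biUnion fun d =>
      (rowCfgs s (Fin.tail a) d).map ⟨Fin.cons b, Fin.cons_right_injective (α := fun _ => ℕ) b⟩

theorem mem_rowCfgs {s : ℕ} {a : Fin s → ℕ} {b : ℕ} {h : Fin (s + 1) → ℕ} :
    h ∈ rowCfgs s a b ↔ h 0 = b ∧ ∀ j : Fin s, h j.succ ≤ a j + h j.castSucc := by
  induction s generalizing b with
  | zero =>
    simp only [rowCfgs, Finset.mem_singleton, IsEmpty.forall_iff, and_true]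
    refine ⟨fun e => by rw [e], fun e => funext fun i => ?_⟩
    rw [Subsingleton.elim (α := Fin 1) i 0, e]
  | succ s ih =>
    simp only [rowCfgs, Finset.mem_biUnion, Finset.mem_range, Finset.mem_map, ih,
      Function.Embedding.coeFn_mk]
    constructor
    · rintro ⟨d, hd, h, ⟨h0, hs⟩, rfl⟩
      refine ⟨rfl, fun j => ?_⟩
      refine Fin.cases ?_ (fun j => ?_) j
      · simp only [Fin.cons_succ, Fin.castSucc_zero, Fin.cons_zero]; omega
      · simpa [Fin.tail] using hs j
    · rintro ⟨h0, hs⟩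
      refine ⟨h 1, ?_, Fin.tail h, ⟨rfl, fun j => ?_⟩, ?_⟩
      · have := hs 0
        simp only [Fin.castSucc_zero, h0, Fin.succ_zero_eq_one] at this
        omega
      · simpa [Fin.tail] using hs j.succ
      · rw [← h0]; exact Fin.cons_self_tail h

theorem sum_rowCfgs_succ {M : Type*} [AddCommMonoid M] {s : ℕ} (a : Fin (s + 1) → ℕ) (b : ℕ)
    (F : (Fin (s + 2) → ℕ) → M) :
    ∑ h ∈ rowCfgs (s + 1) a b, F h = ∑ d ∈ Finset.range (a 0 + b + 1),
      ∑ h ∈ rowCfgs s (Fin.tail a) d, F (Fin.cons b h : Fin (s + 2) → ℕ) := by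
  rw [rowCfgs, Finset.sum_biUnion]
  · simp
  · intro d _ d' _ hne
    refine Finset.disjoint_left.2 fun h hd hd' => hne ?_
    obtain ⟨h1, hm1, rfl⟩ := Finset.mem_map.1 hd
    obtain ⟨h2, hm2, e⟩ := Finset.mem_map.1 hd'
    have : h2 = h1 := Fin.cons_right_injective (α := fun _ => ℕ) b e
    rw [← (mem_rowCfgs.1 hm1).1, ← (mem_rowCfgs.1 hm2).1, this]

/-- The top labels of a row with bottom labels `a` and horizontal labels `h`. -/
def rowTop {s : ℕ} (a : Fin s → ℕ) (h : Fin (s + 1) → ℕ) (j : Fin s) : ℕ :=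
  a j + h j.castSucc - h j.succ

/-- Add a row at the bottom of a labelling. -/
def consRow {r s : ℕ} (a : Fin s → ℕ) (h : Fin (s + 1) → ℕ) (C : Labelling r s) :
    Labelling (r + 1) s where
  vert := Fin.cons a C.vert
  horiz := Fin.cons h C.horiz

theorem consRow_injective {r s : ℕ} (a : Fin s → ℕ) (h : Fin (s + 1) → ℕ) :
    Function.Injective (consRow a h : Labelling r s → Labelling (r + 1) s) := by
  intro C C' e
  have e1 := congrArg Labelling.vert e
  have e2 := congrArg Labelling.horiz e
  exact Labelling.ext (Fin.cons_right_injective (α := fun _ => Fin s → ℕ) a e1)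
    (Fin.cons_right_injective (α := fun _ => Fin (s + 1) → ℕ) h e2)

open Classical in
/-- All configurations with given bottom and left labels. -/
noncomputable def gridCfgs {s : ℕ} : (r : ℕ) → (Fin s → ℕ) → (Fin r → ℕ) →
    Finset (Labelling r s)
  | 0, a, _ => {⟨fun _ => a, Fin.elim0⟩}
  | r + 1, a, l => (rowCfgs s a (l 0)).biUnion fun h =>
      (gridCfgs r (rowTop a h) (Fin.tail l)).map ⟨consRow a h, consRow_injective a h⟩

theorem mem_gridCfgs {r s : ℕ} {a : Fin s → ℕ} {l : Fin r → ℕ} {C : Labelling r s} :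
    C ∈ gridCfgs r a l ↔ (∀ i j, C.vert i.castSucc j + C.horiz i j.castSucc
          = C.vert i.succ j + C.horiz i j.succ) ∧ C.vert 0 = a ∧ ∀ i, C.horiz i 0 = l i := by
  induction r generalizing a with
  | zero =>
    simp only [gridCfgs, Finset.mem_singleton, IsEmpty.forall_iff, and_true, true_and]
    refine ⟨fun e => by rw [e], fun e => Labelling.ext (funext fun i => ?_) (funext fun i => ?_)⟩
    · rw [← e, Subsingleton.elim (α := Fin 1) i 0]
    · exact i.elim0
  | succ r ih =>
    simp only [gridCfgs, Finset.mem_biUnion, Finset.mem_map, ih, Function.Embedding.coeFn_mk,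
      mem_rowCfgs]
    constructor
    · rintro ⟨h, ⟨h0, hs⟩, C, ⟨hc, hv, hl⟩, rfl⟩
      refine ⟨fun i j => ?_, rfl, fun i => ?_⟩
      · refine Fin.cases ?_ (fun i => ?_) i
        · have e : C.vert 0 j = rowTop a h j := by rw [hv]
          have := hs j
          simp only [consRow, Fin.castSucc_zero, Fin.cons_zero, Fin.cons_succ, e, rowTop]
          omega
        · simpa [consRow] using hc i j
      · refine Fin.cases ?_ (fun i => ?_) i
        · simpa [consRow] using h0
        · simpa [consRow, Fin.tail] using hl i
    · rintro ⟨hc, hv, hl⟩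
      refine ⟨C.horiz 0, ⟨hl 0, fun j => ?_⟩, ⟨Fin.tail C.vert, Fin.tail C.horiz⟩,
        ⟨fun i j => ?_, ?_, fun i => ?_⟩, ?_⟩
      · have := hc 0 j
        simp only [Fin.castSucc_zero, hv] at this
        omega
      · simpa [Fin.tail] using hc i.succ j
      · funext j
        have := hc 0 j
        simp only [Fin.castSucc_zero, hv] at this
        simp only [Fin.tail, rowTop]
        omega
      · exact hl i.succ
      · refine Labelling.ext ?_ ?_
        · rw [← hv]; exact Fin.cons_self_tail C.vert
        · exact Fin.cons_self_tail C.horiz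

theorem sum_gridCfgs_succ {M : Type*} [AddCommMonoid M] {r s : ℕ} (a : Fin s → ℕ)
    (l : Fin (r + 1) → ℕ) (F : Labelling (r + 1) s → M) :
    ∑ C ∈ gridCfgs (r + 1) a l, F C = ∑ h ∈ rowCfgs s a (l 0),
      ∑ C ∈ gridCfgs r (rowTop a h) (Fin.tail l), F (consRow a h C) := by
  classical
  rw [gridCfgs, Finset.sum_biUnion]
  · simp
  · intro d _ d' _ hne
    refine Finset.disjoint_left.2 fun h hd hd' => hne ?_
    obtain ⟨h1, hm1, rfl⟩ := Finset.mem_map.1 hd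
    obtain ⟨h2, hm2, e⟩ := Finset.mem_map.1 hd'
    exact (congrFun (congrArg Labelling.horiz e) 0).symm

variable {K : Type*} [Field K]

/-- The product of the vertex weights of a labelling. -/
def cfgWeight {r s : ℕ} (w : Fin r → Fin s → ℕ → ℕ → ℕ → ℕ → K) (C : Labelling r s) : K :=
  ∏ i : Fin r, ∏ j : Fin s,
    w i j (C.vert i.castSucc j) (C.horiz i j.castSucc) (C.vert i.succ j) (C.horiz i j.succ)

-- The enumeration by rows fixes only the bottom and left labels; the top and right conditions
-- become an indicator, to be used as the function on which the crossings act.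
open Classical in
theorem partitionFunction_eq_sum {r s : ℕ} (w : Fin r → Fin s → ℕ → ℕ → ℕ → ℕ → K)
    (bottom : Fin s → ℕ) (left : Fin r → ℕ) (right : Set (Fin r → ℕ)) :
    partitionFunction w bottom left right
      = ∑ C ∈ gridCfgs r bottom left, cfgWeight w C *
        if C.vert (Fin.last r) = 0 ∧ (fun i => C.horiz i (Fin.last s)) ∈ right then 1 else 0 := by
  simp only [mul_ite, mul_one, mul_zero]
  rw [← Finset.sum_filter, partitionFunction, ← finsum_mem_coe_finset]
  have : configs bottom left right = ↑((gridCfgs r bottom left).filter fun C =>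
      C.vert (Fin.last r) = 0 ∧ (fun i => C.horiz i (Fin.last s)) ∈ right) := by
    ext C
    simp only [configs, Set.mem_ofPred_eq, Finset.coe_filter, mem_gridCfgs, funext_iff,
      Pi.zero_apply]
    tauto
  rw [this]
  rfl

variable {ι : Type*} [DecidableEq ι]

/-- A row leaves all other lines unchanged, so `g` needs to describe `f` only for the frozen values
of `σ` there. The induction removes the leftmost column. -/
theorem row_prod_apply {s : ℕ} (w : Fin s → ℕ → ℕ → ℕ → ℕ → K) (col : Fin s → ι) (row : ι)
    (hcol : Function.Injective col) (hrow : ∀ j, col j ≠ row) (f : (ι → ℕ) → K)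
    (g : (Fin s → ℕ) → ℕ → K) (σ : ι → ℕ)
    (hf : ∀ σ' : ι → ℕ, (∀ l, (∀ j, l ≠ col j) → l ≠ row → σ' l = σ l) →
      f σ' = g (σ' ∘ col) (σ' row)) :
    (List.ofFn fun j => crossing (w j) (col j) row).prod f σ
      = ∑ h ∈ rowCfgs s (σ ∘ col) (σ row),
        (∏ j : Fin s, w j (σ (col j)) (h j.castSucc) (rowTop (σ ∘ col) h j) (h j.succ)) *
          g (rowTop (σ ∘ col) h) (h (Fin.last s)) := by
  induction s generalizing σ with
  | zero =>
    simp only [List.ofFn_zero, List.prod_nil, Module.End.one_apply, rowCfgs, Finset.sum_singleton,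
      Finset.univ_eq_empty, Finset.prod_empty, one_mul]
    rw [hf σ fun _ _ _ => rfl]
    congr 1
    exact Subsingleton.elim _ _
  | succ s ih =>
    rw [List.ofFn_succ, List.prod_cons, Module.End.mul_apply, crossing_apply, sum_rowCfgs_succ,
      -- The antidiagonal is indexed by the top label; the reflection indexes it by the right label
      -- `d`, as in `rowCfgs`.
      Finset.Nat.sum_antidiagonal_eq_sum_range_succ_mk, ← Finset.sum_range_reflect]
    refine Finset.sum_congr rfl fun d hd => ?_
    have hd' : d ≤ σ (col 0) + σ row := Nat.lt_succ_iff.1 (Finset.mem_range.1 hd)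
    simp only [Nat.succ_eq_add_one]
    rw [show σ (col 0) + σ row + 1 - 1 - d = σ (col 0) + σ row - d by omega,
      Nat.sub_sub_self hd']
    set c := σ (col 0) + σ row - d
    set σ₁ := setState (col 0) row c d σ with hσ₁
    have h0 : σ₁ (col 0) = c := setState_left (hrow 0) _ _ _
    have h1 : σ₁ row = d := setState_right _ _ _ _ _
    have h2 : ∀ j : Fin s, σ₁ (col j.succ) = σ (col j.succ) := fun j =>
      setState_of_ne (fun e => Fin.succ_ne_zero j (hcol e)) (hrow _) _ _ _
    have h3 : σ₁ ∘ (fun j : Fin s => col j.succ) = Fin.tail (σ ∘ col) := funext h2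
    rw [ih (fun j => w j.succ) (fun j => col j.succ) (fun a b e => Fin.succ_injective s (hcol e))
      (fun j => hrow _) (fun c' d' => g (Fin.cons c c') d') σ₁, h1, h3, Finset.mul_sum]
    · refine Finset.sum_congr rfl fun h hh => ?_
      have hh0 := (mem_rowCfgs.1 hh).1
      rw [Fin.prod_univ_succ]
      have e1 : rowTop (σ ∘ col) (Fin.cons (σ row) h : Fin (s + 2) → ℕ)
          = Fin.cons c (rowTop (Fin.tail (σ ∘ col)) h) := by
        funext j
        refine Fin.cases ?_ (fun j => ?_) j
        · simp [rowTop, hh0, c]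
        · simp [rowTop, Fin.tail]
      rw [e1]
      simp only [Fin.castSucc_zero, Fin.cons_zero, Fin.cons_succ, hh0, h2,
        ← Fin.succ_castSucc, ← Fin.succ_last]
      ring
    · intro σ' hσ'
      rw [hf σ' fun l hl hr => ?_]
      · congr 1
        funext j
        refine Fin.cases ?_ (fun j => ?_) j
        · rw [Function.comp_apply, hσ' (col 0) (fun j e => Fin.succ_ne_zero j (hcol e).symm)
            (hrow 0), h0, Fin.cons_zero]
        · simp
      · rw [hσ' l (fun j => hl _) hr]
        exact setState_of_ne (hl 0) hr _ _ _

/-- Listing crossings row by row upwards, and from left to right in each row, respects the direction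
of the particles. The bottom row is evaluated against the sum over configurations of the rows above
it. -/
theorem grid_prod_apply {r s : ℕ} (w : Fin r → Fin s → ℕ → ℕ → ℕ → ℕ → K) (col : Fin s → ι)
    (row : Fin r → ι) (hcol : Function.Injective col) (hrow : Function.Injective row)
    (hcr : ∀ i j, col j ≠ row i) (f : (ι → ℕ) → K)
    (g : (Fin s → ℕ) → (Fin r → ℕ) → K) (σ : ι → ℕ)
    (hf : ∀ σ' : ι → ℕ, (∀ l, (∀ j, l ≠ col j) → (∀ i, l ≠ row i) → σ' l = σ l) →
      f σ' = g (σ' ∘ col) (σ' ∘ row)) :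
    (List.ofFn fun i => (List.ofFn fun j => crossing (w i j) (col j) (row i)).prod).prod f σ
      = ∑ C ∈ gridCfgs r (σ ∘ col) (σ ∘ row), cfgWeight w C *
          g (C.vert (Fin.last r)) (fun i => C.horiz i (Fin.last s)) := by
  induction r generalizing σ with
  | zero =>
    simp only [List.ofFn_zero, List.prod_nil, Module.End.one_apply, gridCfgs,
      Finset.sum_singleton, cfgWeight, Finset.univ_eq_empty, Finset.prod_empty, one_mul]
    rw [hf σ fun _ _ _ => rfl]
    congr 1
    exact Subsingleton.elim _ _
  | succ r ih =>
    rw [List.ofFn_succ, List.prod_cons, Module.End.mul_apply, sum_gridCfgs_succ]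
    rw [row_prod_apply (w 0) col (row 0) hcol (hcr 0) _ (fun c d =>
      ∑ C ∈ gridCfgs r c (Fin.tail (σ ∘ row)), cfgWeight (fun i => w i.succ) C *
        g (C.vert (Fin.last r))
          (Fin.cons d (fun i => C.horiz i (Fin.last s)) : Fin (r + 1) → ℕ)) σ]
    · refine Finset.sum_congr rfl fun h _ => ?_
      rw [Finset.mul_sum]
      refine Finset.sum_congr rfl fun C hC => ?_
      have e0 : C.vert 0 = rowTop (σ ∘ col) h := (mem_gridCfgs.1 hC).2.1
      have e1 : cfgWeight w (consRow (σ ∘ col) h C)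
          = (∏ j : Fin s, w 0 j (σ (col j)) (h j.castSucc) (rowTop (σ ∘ col) h j) (h j.succ)) *
            cfgWeight (fun i => w i.succ) C := by
        rw [cfgWeight, Fin.prod_univ_succ]
        simp only [consRow, Fin.castSucc_zero, Fin.cons_zero, Fin.cons_succ, e0,
          Function.comp_apply, ← Fin.succ_castSucc]
        rfl
      have e2 : (fun i => (consRow (σ ∘ col) h C).horiz i (Fin.last s))
          = (Fin.cons (h (Fin.last s)) (fun i => C.horiz i (Fin.last s)) : Fin (r + 1) → ℕ) := by
        funext i
        refine Fin.cases ?_ (fun i => ?_) i <;> simp [consRow]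
      rw [e1, e2, mul_assoc]
      congr 3
    · intro σ' hσ'
      have h1 : σ' ∘ (fun i : Fin r => row i.succ) = Fin.tail (σ ∘ row) := funext fun i =>
        hσ' _ (fun j e => hcr _ _ e.symm) (fun e => Fin.succ_ne_zero i (hrow e))
      rw [ih (fun i => w i.succ) (fun i => row i.succ) (fun a b e => Fin.succ_injective r (hrow e))
        (fun i => hcr _) (fun c d => g c (Fin.cons (σ' (row 0)) d)) σ', h1]
      intro σ'' hσ''
      rw [hf σ'' fun l hl hr => (hσ'' l hl fun i => hr _).trans (hσ' l hl (hr 0))]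
      congr 1
      funext i
      refine Fin.cases ?_ (fun i => ?_) i
      · rw [Function.comp_apply, hσ'' (row 0) (fun j e => hcr _ _ e.symm)
          (fun i e => Fin.succ_ne_zero i (hrow e).symm), Fin.cons_zero]
      · simp

end Configurations


/-! ### Numbering of the columns -/

section Columns

/-- The columns of a lattice from left to right, numbered `N, N - 1, …, 1`. -/
def colList : ℕ → List ℕ
  | 0 => []
  | N + 1 => (N + 1) :: colList N

theorem mem_colList {N i : ℕ} : i ∈ colList N ↔ 1 ≤ i ∧ i ≤ N := by
  induction N with
  | zero => simp only [colList, List.not_mem_nil, false_iff]; omega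
  | succ N ih => simp only [colList, List.mem_cons, ih]; omega

theorem nodup_colList (N : ℕ) : (colList N).Nodup := by
  induction N with
  | zero => exact List.nodup_nil
  | succ N ih =>
    refine List.nodup_cons.2 ⟨fun h => ?_, ih⟩
    have := mem_colList.1 h
    omega

theorem colList_add (n m : ℕ) : colList (n + m) = (colList m).map (n + ·) ++ colList n := by
  induction m with
  | zero => simp [colList]
  | succ m ih => simp [colList, ih, ← add_assoc]

theorem ofFn_sub_eq_map_colList {α : Type*} (g : ℕ → α) (s : ℕ) :
    List.ofFn (fun j : Fin s => g (s - j)) = (colList s).map g := by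
  induction s with
  | zero => simp [colList]
  | succ s ih =>
    rw [List.ofFn_succ, colList, List.map_cons, ← ih]
    simp

theorem ofFn_succ_eq_map_colList_reverse {α : Type*} (g : ℕ → α) (n : ℕ) :
    List.ofFn (fun i : Fin n => g (i + 1)) = (colList n).reverse.map g := by
  induction n with
  | zero => simp [colList]
  | succ n ih =>
    rw [List.ofFn_succ', List.concat_eq_append, colList, List.reverse_cons, List.map_append, ← ih]
    simp

end Columns

/-! ### Locality and removal of empty columns -/

section Locality

variable {K : Type*} [Field K] {ι : Type*}

/-- An operator that changes only the labels of the lines in `S`. -/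
def IsLocal (S : Set ι) (T : Module.End K ((ι → ℕ) → K)) : Prop :=
  ∀ (f f' : (ι → ℕ) → K) (σ : ι → ℕ),
    (∀ σ' : ι → ℕ, (∀ l, l ∉ S → σ' l = σ l) → f σ' = f' σ') → T f σ = T f' σ

theorem IsLocal.mul {S : Set ι} {T U : Module.End K ((ι → ℕ) → K)} (hT : IsLocal S T)
    (hU : IsLocal S U) : IsLocal S (T * U) := fun f f' σ h =>
  hT (U f) (U f') σ fun _ h1 => hU f f' _ fun σ'' h2 =>
    h σ'' fun l hl => (h2 l hl).trans (h1 l hl)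

theorem isLocal_one (S : Set ι) : IsLocal S (1 : Module.End K ((ι → ℕ) → K)) :=
  fun _ _ σ h => h σ fun _ _ => rfl

theorem isLocal_list_prod {S : Set ι} (L : List (Module.End K ((ι → ℕ) → K)))
    (h : ∀ T ∈ L, IsLocal S T) : IsLocal S L.prod := by
  induction L with
  | nil => exact isLocal_one S
  | cons T L ih =>
    rw [List.prod_cons]
    exact (h T List.mem_cons_self).mul (ih fun U hU => h U (List.mem_cons_of_mem T hU))

variable [DecidableEq ι]

theorem isLocal_crossing {S : Set ι} (w : ℕ → ℕ → ℕ → ℕ → K) {i j : ι} (hi : i ∈ S)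
    (hj : j ∈ S) : IsLocal S (crossing w i j) := by
  intro f f' σ h
  simp only [crossing_apply]
  refine Finset.sum_congr rfl fun p _ => ?_
  rw [h (setState i j p.1 p.2 σ) fun l hl =>
    setState_of_ne (ne_of_mem_of_not_mem hi hl).symm (ne_of_mem_of_not_mem hj hl).symm _ _ _]

theorem crossing_apply_of_zero (w : ℕ → ℕ → ℕ → ℕ → K) (hw : w 0 0 0 0 = 1) {i j : ι}
    (f : (ι → ℕ) → K) {σ : ι → ℕ} (hi : σ i = 0) (hj : σ j = 0) : crossing w i j f σ = f σ := by
  rw [crossing_apply, hi, hj]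
  simp only [add_zero, Finset.Nat.antidiagonal_zero, Finset.sum_singleton, hw, one_mul]
  congr 1
  funext l
  simp only [setState, Function.update_apply]
  split_ifs with h1 h2
  · rw [h1, hj]
  · rw [h2, hi]
  · rfl

theorem list_prod_apply_of_zero {α : Type*} (w : α → ℕ → ℕ → ℕ → ℕ → K)
    (hw : ∀ i, w i 0 0 0 0 = 1) (z : α → ι) (row : ι) (L : List α) (f : (ι → ℕ) → K)
    {σ : ι → ℕ} (hz : ∀ i ∈ L, σ (z i) = 0) (hrow : σ row = 0) :
    (L.map fun i => crossing (w i) (z i) row).prod f σ = f σ := by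
  induction L with
  | nil => rfl
  | cons i L ih =>
    rw [List.map_cons, List.prod_cons, Module.End.mul_apply,
      crossing_apply_of_zero _ (hw i) _ (hz i List.mem_cons_self) hrow]
    exact ih fun k hk => hz k (List.mem_cons_of_mem i hk)

/-- Empty columns at the left of a lattice can be dropped. -/
theorem list_prod_drop_empty {α β : Type*} (w : β → α → ℕ → ℕ → ℕ → ℕ → K)
    (hw : ∀ k i, w k i 0 0 0 0 = 1) (z : α → ι) (row : β → ι) (Z : List α)
    (T : β → Module.End K ((ι → ℕ) → K)) (S : β → Set ι) (hT : ∀ k, IsLocal (S k) (T k))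
    (hz : ∀ k, ∀ i ∈ Z, z i ∉ S k) (hS : ∀ k k', k ≠ k' → row k' ∉ S k) (L : List β)
    (hL : L.Nodup) (f f' : (ι → ℕ) → K) (hf : ∀ σ, (∀ i ∈ Z, σ (z i) = 0) → f σ = f' σ)
    {σ : ι → ℕ} (hσ : ∀ i ∈ Z, σ (z i) = 0) (hrow : ∀ k ∈ L, σ (row k) = 0) :
    (L.map fun k => (Z.map fun i => crossing (w k i) (z i) (row k)).prod * T k).prod f σ
      = (L.map T).prod f' σ := by
  induction L generalizing σ with
  | nil => exact hf σ hσ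
  | cons k L ih =>
    have hk := (List.nodup_cons.1 hL).1
    simp only [List.map_cons, List.prod_cons, Module.End.mul_apply]
    rw [list_prod_apply_of_zero (w k) (hw k) z (row k) Z _ hσ (hrow k List.mem_cons_self)]
    -- `T k` changes only lines in `S k`, so the columns in `Z` and the later rows are still empty
    -- after it.
    refine hT k _ _ σ fun σ' hσ' => ?_
    refine ih (List.nodup_cons.1 hL).2 (fun i hi => ?_) (fun k' hk' => ?_)
    · rw [hσ' _ (hz k i hi), hσ i hi]
    · rw [hσ' _ (hS k k' fun e => hk (e ▸ hk')), hrow k' (List.mem_cons_of_mem k hk')]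

end Locality

/-! ### Rows and the vanishing mechanism for v = 0 -/

section Rows

variable {K : Type*} [Field K] {ι : Type*} [DecidableEq ι]

theorem weightG_zero {q : K} (hq : ∀ k : ℕ, 0 < k → q ^ k ≠ 1) (x u v : K) :
    weightG q x u v 0 0 0 0 = 1 := by
  have := gaussBinom_self hq 0
  rw [gaussBinom_of_le q le_rfl] at this
  simp [weightG, qPoch_zero_right, this]

theorem weightD_zero {q : K} (hq : ∀ k : ℕ, 0 < k → q ^ k ≠ 1) (y u v : K) :
    weightD q y u v 0 0 0 0 = 1 := by
  have := gaussBinom_self hq 0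
  rw [gaussBinom_of_le q le_rfl] at this
  simp [weightD, qPoch_zero_right, this]

/-- Every term has `p ≤ c < b`, hence a positive power of `v / x = 0`. Thus such a column sends up
at least as many particles as enter it from the left. -/
theorem weightG_eq_zero_of_lt (q x u : K) {a b c d : ℕ} (h : c < b) :
    weightG q x u 0 a b c d = 0 := by
  rw [weightG]
  split_ifs
  · rw [Finset.sum_eq_zero, mul_zero]
    intro p hp
    have := Finset.mem_range.1 hp
    rw [zero_div, zero_pow (by omega)]
    simp
  · rfl

/-- The line `row` crossing the columns `c N, …, c 1`. -/
def rowOp (q x : K) (u v : ℕ → K) (c : ℕ → ι) (row : ι) (N : ℕ) :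
    Module.End K ((ι → ℕ) → K) :=
  ((colList N).map fun i => crossing (weightG q x (u i) (v i)) (c i) row).prod

/-- The indicator function of the states in which the columns `c N, …, c 1` are empty. -/
noncomputable def emptyInd (K : Type*) [Field K] {ι : Type*} (c : ℕ → ι) (N : ℕ) (σ : ι → ℕ) : K :=
  open Classical in if ∀ i, 1 ≤ i → i ≤ N → σ (c i) = 0 then 1 else 0

theorem rowOp_succ (q x : K) (u v : ℕ → K) (c : ℕ → ι) (row : ι) (N : ℕ) :
    rowOp q x u v c row (N + 1)
      = crossing (weightG q x (u (N + 1)) (v (N + 1))) (c (N + 1)) row *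
        rowOp q x u v c row N := by
  simp [rowOp, colList]

theorem isLocal_rowOp (q x : K) (u v : ℕ → K) (c : ℕ → ι) (row : ι) (N : ℕ) :
    IsLocal ({l | l = row ∨ ∃ i, 1 ≤ i ∧ i ≤ N ∧ l = c i} : Set ι)
      (rowOp q x u v c row N) := by
  refine isLocal_list_prod _ fun T hT => ?_
  obtain ⟨i, hi, rfl⟩ := List.mem_map.1 hT
  have hi' := mem_colList.1 hi
  exact isLocal_crossing _ (Or.inr ⟨i, hi'.1, hi'.2, rfl⟩) (Or.inl rfl)

/-- Empty columns `z M, …, z 1` at the left of the columns `c N, …, c 1` can be dropped. -/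
theorem rows_drop_empty {q : K} (hq : ∀ k : ℕ, 0 < k → q ^ k ≠ 1) {β : Type*} (x : β → K)
    (u v u' v' : ℕ → K) {z c : ℕ → ι} {M N : ℕ} (hzc : ∀ i j, 1 ≤ i → j ≤ N → z i ≠ c j)
    {row : β → ι} (hrow : Function.Injective row) (hzr : ∀ i k, z i ≠ row k)
    (hcr : ∀ i k, c i ≠ row k) (L : List β) (hL : L.Nodup) (f f' : (ι → ℕ) → K)
    (hf : ∀ σ, (∀ i, 1 ≤ i → i ≤ M → σ (z i) = 0) → f σ = f' σ) {σ : ι → ℕ}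
    (hσ : ∀ i, 1 ≤ i → i ≤ M → σ (z i) = 0) (hσr : ∀ k, σ (row k) = 0) :
    (L.map fun k => rowOp q (x k) u v z (row k) M * rowOp q (x k) u' v' c (row k) N).prod f σ
      = (L.map fun k => rowOp q (x k) u' v' c (row k) N).prod f' σ := by
  refine list_prod_drop_empty (fun k i => weightG q (x k) (u i) (v i))
    (fun k i => weightG_zero hq _ _ _) z row (colList M)
    (fun k => rowOp q (x k) u' v' c (row k) N)
    (fun k => {l | l = row k ∨ ∃ i, 1 ≤ i ∧ i ≤ N ∧ l = c i})
    (fun k => isLocal_rowOp q (x k) u' v' c (row k) N) (fun k i hi => ?_) (fun k k' hk => ?_)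
    L hL f f' (fun σ' h => hf σ' fun i h1 h2 => h i (mem_colList.2 ⟨h1, h2⟩))
    (fun i hi => hσ i (mem_colList.1 hi).1 (mem_colList.1 hi).2) (fun k _ => hσr k)
  · rintro (h | ⟨j, hj, hjN, h⟩)
    · exact hzr _ _ h
    · exact hzc i j (mem_colList.1 hi).1 hjN h
  · rintro (h | ⟨j, hj, hjN, h⟩)
    · exact hk (hrow h).symm
    · exact hcr _ _ h.symm

/-- A particle entering the row, or starting left of column `k + 1`, either goes up in a column
beyond `k`, where `f` vanishes, or forces a positive left label at column `k + 1`. There `v = 0`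
makes the top label positive, and `f` vanishes again. Each row thus extends the possibly occupied
columns by at most one. -/
theorem rowOp_apply_eq_zero (q x : K) (u v : ℕ → K) {c : ℕ → ι} (hc : Function.Injective c)
    {row : ι} (hrow : ∀ i, c i ≠ row) {k N : ℕ} (hv : v (k + 1) = 0) (f : (ι → ℕ) → K)
    (hf : ∀ σ : ι → ℕ, (∃ i, k < i ∧ i ≤ N ∧ σ (c i) ≠ 0) → f σ = 0) {M : ℕ} (hkM : k + 1 ≤ M) :
    M ≤ N → ∀ σ : ι → ℕ, (σ row ≠ 0 ∨ ∃ i, k + 1 < i ∧ i ≤ M ∧ σ (c i) ≠ 0) →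
      rowOp q x u v c row M f σ = 0 := by
  -- Columns left of the remaining part of the row keep their labels, so an occupied one beyond `k`
  -- already makes the result zero.
  have hloc : ∀ M σ, (∃ i, M < i ∧ k < i ∧ i ≤ N ∧ σ (c i) ≠ 0) →
      rowOp q x u v c row M f σ = 0 := by
    rintro M σ ⟨i, hMi, hki, hiN, hi⟩
    rw [isLocal_rowOp q x u v c row M f 0 σ fun σ' hσ' => ?_]
    · simp
    · refine hf σ' ⟨i, hki, hiN, ?_⟩
      rw [hσ']
      · exact hi
      · rintro (h | ⟨j, -, hj, h⟩)
        · exact hrow i h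
        · have := hc h
          omega
  induction M, hkM using Nat.le_induction with
  | base =>
    intro hN σ hσ
    have hb : σ row ≠ 0 := by
      rcases hσ with h | ⟨i, h1, h2, -⟩
      · exact h
      · omega
    rw [rowOp_succ, Module.End.mul_apply, crossing_apply, hv]
    refine Finset.sum_eq_zero fun p _ => ?_
    by_cases h : p.1 < σ row
    · rw [weightG_eq_zero_of_lt _ _ _ h, zero_mul]
    · rw [hloc k _ ⟨k + 1, by omega, by omega, hN, ?_⟩, mul_zero]
      rw [setState_left (hrow _)]
      omega
  | succ M hM ih =>
    intro hN σ hσ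
    rw [rowOp_succ, Module.End.mul_apply, crossing_apply]
    refine Finset.sum_eq_zero fun p hp => ?_
    have hp' := Finset.HasAntidiagonal.mem_antidiagonal.1 hp
    by_cases h : p.1 = 0
    · rw [ih (by omega), mul_zero]
      by_cases h2 : p.2 = 0
      · right
        have h3 : σ row = 0 := by omega
        have h4 : σ (c (M + 1)) = 0 := by omega
        rcases hσ with h | ⟨i, h5, h6, h7⟩
        · exact absurd h3 h
        · have h8 : i ≠ M + 1 := fun e => h7 (e ▸ h4)
          refine ⟨i, h5, by omega, ?_⟩
          rwa [setState_of_ne (fun e => h8 (hc e)) (hrow i)]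
      · left
        rwa [setState_right]
    · rw [hloc M _ ⟨M + 1, by omega, by omega, hN, ?_⟩, mul_zero]
      rwa [setState_left (hrow _)]

/-- If the `n` rightmost columns have `v = 0`, then particles starting further to the left cannot
leave the lattice within `n` rows. -/
theorem rows_apply_eq_zero {β : Type*} (q : K) (x : β → K) (u v : ℕ → K) {c : ℕ → ι}
    (hc : Function.Injective c) {row : β → ι} (hrow : ∀ i k, c i ≠ row k) {n N : ℕ}
    (hv : ∀ i, i ≤ n → v i = 0) (L : List β) (hL : L.length ≤ n) (σ : ι → ℕ)
    (hσ : ∃ i, L.length < i ∧ i ≤ N ∧ σ (c i) ≠ 0) :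
    (L.map fun k => rowOp q (x k) u v c (row k) N).prod (emptyInd K c N) σ = 0 := by
  induction L generalizing σ with
  | nil =>
    obtain ⟨i, h1, h2, h3⟩ := hσ
    exact if_neg fun h => h3 (h i h1 h2)
  | cons k L ih =>
    rw [List.length_cons] at hL hσ
    rw [List.map_cons, List.prod_cons, Module.End.mul_apply]
    obtain ⟨i, h1, h2, h3⟩ := hσ
    exact rowOp_apply_eq_zero q (x k) u v hc (fun i => hrow i k) (hv _ hL) _
      (fun σ' h => ih (by omega) σ' h) (by omega) le_rfl σ (Or.inr ⟨i, h1, h2, h3⟩)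

end Rows


/-! ### Partitions described by column multiplicities -/

section Partitions

theorem colMult_eq_zero {lam : YoungDiagram} {i : ℕ} (h : lam.colLen 0 < i) :
    colMult lam i = 0 := by
  refine List.count_eq_zero_of_not_mem fun hi => ?_
  obtain ⟨k, -, rfl⟩ := List.mem_map.1 hi
  rw [YoungDiagram.rowLen_transpose] at h
  exact absurd (lam.colLen_anti 0 k (Nat.zero_le k)) (by omega)

theorem colMult_zero (lam : YoungDiagram) : colMult lam 0 = 0 :=
  List.count_eq_zero_of_not_mem fun h => lt_irrefl 0 (lam.transpose.pos_of_mem_rowLens 0 h)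

theorem colMult_colLen_ne_zero {lam : YoungDiagram} (h : 0 < lam.colLen 0) :
    colMult lam (lam.colLen 0) ≠ 0 := by
  refine (List.count_pos_iff.2 (List.mem_map.2 ⟨0, ?_, ?_⟩)).ne'
  · rw [List.mem_range, YoungDiagram.colLen_transpose, ← YoungDiagram.mem_iff_lt_rowLen,
      YoungDiagram.mem_iff_lt_colLen]
    exact h
  · rw [YoungDiagram.rowLen_transpose]

theorem eq_of_colMult_eq {lam mu : YoungDiagram} (h : ∀ i, colMult lam i = colMult mu i) :
    lam = mu := by
  rw [← YoungDiagram.transpose_eq_iff]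
  apply YoungDiagram.equivListRowLens.injective
  refine Subtype.ext ?_
  exact (List.perm_iff_count.2 h).eq_of_sortedGE lam.transpose.rowLens_sorted
    mu.transpose.rowLens_sorted

theorem exists_colMult_eq {n : ℕ} (r : Fin n → ℕ) : ∃ mu : YoungDiagram,
    mu.colLen 0 ≤ n ∧ ∀ i : Fin n, colMult mu (i + 1) = r i := by
  let s : Multiset ℕ := ∑ i : Fin n, Multiset.replicate (r i) ((i : ℕ) + 1)
  have hs : ∀ m ∈ s, 0 < m ∧ m ≤ n := by
    intro m hm
    obtain ⟨i, -, hi⟩ := Multiset.mem_sum.1 hm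
    rw [Multiset.eq_of_mem_replicate hi]
    omega
  let L := s.sort (· ≥ ·)
  have hL : L.SortedGE := (Multiset.pairwise_sort s (· ≥ ·)).sortedGE
  have hmem : ∀ m ∈ L, 0 < m ∧ m ≤ n := fun m hm => hs m ((Multiset.mem_sort _).1 hm)
  let mu := (YoungDiagram.ofRowLens L hL).transpose
  have hrow : mu.transpose.rowLens = L := by
    rw [YoungDiagram.transpose_transpose]
    exact YoungDiagram.rowLens_ofRowLens_eq_self fun m hm => (hmem m hm).1
  have hcount : ∀ i, colMult mu i = s.count i := fun i => by
    rw [colMult, hrow, ← Multiset.coe_count, Multiset.sort_eq]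
  refine ⟨mu, ?_, fun i => ?_⟩
  · by_contra hlt
    have h1 := colMult_colLen_ne_zero (lam := mu) (by omega)
    rw [hcount] at h1
    exact hlt (hs _ (Multiset.count_ne_zero.1 h1)).2
  · rw [hcount, Multiset.count_sum']
    rw [Finset.sum_eq_single i]
    · simp
    · intro j _ hj
      rw [Multiset.count_replicate, if_neg]
      intro e
      exact hj (Fin.ext (by omega))
    · simp

/-- The partition with at most `n` parts whose diagram has `r i` columns of size `i + 1`. -/
noncomputable def partitionOfColMult {n : ℕ} (r : Fin n → ℕ) : YoungDiagram :=
  (exists_colMult_eq r).choose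

theorem colLen_partitionOfColMult {n : ℕ} (r : Fin n → ℕ) :
    (partitionOfColMult r).colLen 0 ≤ n :=
  (exists_colMult_eq r).choose_spec.1

theorem colMult_partitionOfColMult {n : ℕ} (r : Fin n → ℕ) (i : Fin n) :
    colMult (partitionOfColMult r) (i + 1) = r i :=
  (exists_colMult_eq r).choose_spec.2 i

theorem eq_partitionOfColMult {n : ℕ} {mu : YoungDiagram} (hmu : mu.colLen 0 ≤ n) :
    mu = partitionOfColMult fun i : Fin n => colMult mu (i + 1) := by
  refine eq_of_colMult_eq fun i => ?_
  rcases i with _ | i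
  · rw [colMult_zero, colMult_zero]
  · by_cases hi : i < n
    · exact (colMult_partitionOfColMult (fun i : Fin n => colMult mu (i + 1)) ⟨i, hi⟩).symm
    · have := colLen_partitionOfColMult fun i : Fin n => colMult mu (i + 1)
      rw [colMult_eq_zero (by omega), colMult_eq_zero (by omega)]

end Partitions

/-! ### The polynomials as products of rows -/

section PolyG

variable {K : Type*} [Field K] {ι : Type*} [DecidableEq ι]

/-- `emptyInd` imposes the empty top boundary and ignores the labels of the rows, which leaves the
right boundary free. The reversal appears because the bottom row carries the last variable. -/
theorem polyG_eq_rows_colLen (q : K) (u v : ℕ → K) (lam : YoungDiagram) {n : ℕ} (x : Fin n → K)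
    {c : ℕ → ι} (hc : Function.Injective c) {row : Fin n → ι} (hrow : Function.Injective row)
    (hcr : ∀ i k, c i ≠ row k) {σ : ι → ℕ}
    (hσ : ∀ i, 1 ≤ i → i ≤ lam.colLen 0 → σ (c i) = colMult lam i) (hσr : ∀ k, σ (row k) = 0) :
    polyG q u v lam x
      = ((List.finRange n).map fun k =>
          rowOp q (x k.rev) u v c (row k) (lam.colLen 0)).prod
        (emptyInd K c (lam.colLen 0)) σ := by
  classical
  set s := lam.colLen 0 with hs
  have h1 : ∀ k : Fin n, rowOp q (x k.rev) u v c (row k) s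
      = (List.ofFn fun j : Fin s =>
        crossing (weightG q (x k.rev) (u (s - j)) (v (s - j))) (c (s - j)) (row k)).prod :=
    fun k => by
      rw [rowOp, ofFn_sub_eq_map_colList
        (fun i => crossing (weightG q (x k.rev) (u i) (v i)) (c i) (row k))]
  simp only [h1]
  rw [← List.ofFn_eq_map, polyG, partitionFunction_eq_sum]
  rw [grid_prod_apply (fun (k : Fin n) (j : Fin s) =>
      weightG q (x k.rev) (u (s - j)) (v (s - j))) (fun j => c (s - j)) row
    (fun j j' e => ?_) hrow (fun i j => hcr _ _) (emptyInd K c s)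
    (fun top _ => if top = 0 then 1 else 0) σ (fun σ' _ => ?_)]
  · have e1 : (σ ∘ fun j : Fin s => c (s - j)) = fun j : Fin s => colMult lam (s - j) :=
      funext fun j => hσ _ (by omega) (by omega)
    have e2 : σ ∘ row = fun _ => 0 := funext hσr
    rw [e1, e2]
    refine Finset.sum_congr rfl fun C _ => ?_
    simp only [Set.mem_univ, and_true]
    congr
  · have := hc e
    exact Fin.ext (by omega)
  · rw [emptyInd]
    congr 1
    refine propext ⟨fun h => funext fun j => h _ (by omega) (by omega), fun h i h1 h2 => ?_⟩
    have := congrFun h ⟨s - i, by omega⟩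
    simpa [Nat.sub_sub_self h2] using this

/-- `polyG` computed with any sufficiently large number of columns. -/
theorem polyG_eq_rows {q : K} (hq : ∀ k : ℕ, 0 < k → q ^ k ≠ 1) (u v : ℕ → K)
    (lam : YoungDiagram) {n : ℕ} (x : Fin n → K)
    {c : ℕ → ι} (hc : Function.Injective c) {row : Fin n → ι} (hrow : Function.Injective row)
    (hcr : ∀ i k, c i ≠ row k) {N : ℕ} (hN : lam.colLen 0 ≤ N) {σ : ι → ℕ}
    (hσ : ∀ i, 1 ≤ i → i ≤ N → σ (c i) = colMult lam i) (hσr : ∀ k, σ (row k) = 0) :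
    polyG q u v lam x
      = ((List.finRange n).map fun k => rowOp q (x k.rev) u v c (row k) N).prod
        (emptyInd K c N) σ := by
  obtain ⟨m, rfl⟩ := Nat.exists_eq_add_of_le hN
  rw [polyG_eq_rows_colLen q u v lam x hc hrow hcr
    (fun i h1 h2 => hσ i h1 (h2.trans hN)) hσr]
  set s := lam.colLen 0 with hs
  have h1 : ∀ k : Fin n, rowOp q (x k.rev) u v c (row k) (s + m)
      = rowOp q (x k.rev) (fun i => u (s + i)) (fun i => v (s + i)) (fun i => c (s + i)) (row k) m *
        rowOp q (x k.rev) u v c (row k) s := fun k => by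
    simp only [rowOp, colList_add, List.map_append, List.prod_append, List.map_map,
      Function.comp_def]
  simp only [h1]
  symm
  refine rows_drop_empty hq (fun k : Fin n => x k.rev) _ _ u v (fun i j h1 h2 e => ?_) hrow
    (fun i k => hcr _ _) hcr _ (List.nodup_finRange n) _ _ (fun σ' h => ?_) (fun i h1 h2 => ?_)
    hσr
  · have := hc e
    omega
  · rw [emptyInd, emptyInd]
    congr 1
    refine propext ⟨fun h' i h1 h2 => h' i h1 (by omega), fun h' i h1 h2 => ?_⟩
    by_cases h3 : i ≤ s
    · exact h' i h1 h3
    · have := h (i - s) (by omega) (by omega)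
      rwa [show s + (i - s) = i by omega] at this
  · rw [hσ _ (by omega) (by omega), colMult_eq_zero (by omega)]

/-- `polyG` with `v = 0` vanishes in fewer variables than the partition has parts. -/
theorem polyG_eq_zero_of_lt (q : K) (u : ℕ → K) {mu : YoungDiagram} {n : ℕ} (x : Fin n → K)
    (h : n < mu.colLen 0) : polyG q u (fun _ => 0) mu x = 0 := by
  let c : ℕ → Fin 2 × ℕ := fun i => (0, i)
  let row : Fin n → Fin 2 × ℕ := fun k => (1, k)
  have hc : Function.Injective c := fun a b e => (Prod.ext_iff.1 e).2
  have hrow : Function.Injective row := fun a b e => Fin.ext (Prod.ext_iff.1 e).2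
  have hcr : ∀ i k, c i ≠ row k := fun i k e => by simpa [c, row] using (Prod.ext_iff.1 e).1
  let σ : Fin 2 × ℕ → ℕ := fun l => if l.1 = 0 then colMult mu l.2 else 0
  rw [polyG_eq_rows_colLen q u _ mu x hc hrow hcr (σ := σ) (fun i _ _ => by simp [σ, c])
    (fun k => by simp [σ, row])]
  refine rows_apply_eq_zero (n := n) q (fun k : Fin n => x k.rev) u _ hc hcr (fun _ _ => rfl) _
    (by simp) σ ⟨mu.colLen 0, by simpa using h, le_rfl, ?_⟩
  simpa [σ, c] using colMult_colLen_ne_zero (by omega : 0 < mu.colLen 0)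

end PolyG


/-! ### Moving the rows through the coefficient lattice -/

section Expansion

variable {K : Type*} [Field K] {ι : Type*}

/-- The columns `Y n, …, Y 1` to the right of the columns `U n, …, U 1`. -/
def joinCols (U Y : ℕ → ι) (n i : ℕ) : ι :=
  if i ≤ n then Y i else U (i - n)

theorem emptyInd_joinCols (U Y : ℕ → ι) (n : ℕ) (σ : ι → ℕ) :
    emptyInd K (joinCols U Y n) (n + n) σ = emptyInd K U n σ * emptyInd K Y n σ := by
  simp only [emptyInd, ← ite_and, mul_ite, mul_one, mul_zero]
  congr 1
  refine propext ⟨fun h => ⟨fun i h1 h2 => ?_, fun i h1 h2 => ?_⟩, fun ⟨hY, hU⟩ i h1 h2 => ?_⟩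
  · have := h i h1 (by omega)
    rwa [joinCols, if_pos h2] at this
  · have := h (n + i) (by omega) (by omega)
    rwa [joinCols, if_neg (by omega), Nat.add_sub_cancel_left] at this
  · rw [joinCols]
    split_ifs with h3
    · exact hY i h1 h3
    · exact hU _ (by omega) (by omega)

theorem joinCols_injective {U Y : ℕ → ι} (hU : Function.Injective U) (hY : Function.Injective Y)
    (hUY : ∀ i j, U i ≠ Y j) (n : ℕ) : Function.Injective (joinCols U Y n) := by
  intro i j e
  simp only [joinCols] at e
  split_ifs at e with h1 h2 h2
  · exact hY e
  · exact absurd e.symm (hUY _ _)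
  · exact absurd e (hUY _ _)
  · have := hU e
    omega

variable [DecidableEq ι]

/-- The lattice of the rows `Y 1, …, Y n` (from bottom to top) and the columns `U n, …, U 1`. -/
def gridD (q : K) (u v y : ℕ → K) (U Y : ℕ → ι) (n : ℕ) : Module.End K ((ι → ℕ) → K) :=
  ((colList n).reverse.map fun i =>
    ((colList n).map fun j => crossing (weightD q (y i) (u j) (v j)) (U j) (Y i)).prod).prod

/-- A row can be moved through `gridD`. -/
theorem gridD_semiconjBy {q : K} (hq : ∀ k : ℕ, 0 < k → q ^ k ≠ 1) (u v y : ℕ → K) (n : ℕ)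
    (hy : ∀ i : ℕ, 1 ≤ i → i ≤ n → y i ≠ 0) {U Y : ℕ → ι} (hU : Function.Injective U)
    (hY : Function.Injective Y) (hUY : ∀ i j, U i ≠ Y j) {x : K} (hx : x ≠ 0) {row : ι}
    (hUr : ∀ i, U i ≠ row) (hYr : ∀ i, Y i ≠ row) :
    SemiconjBy (gridD q u v y U Y n)
      (rowOp q x u v U row n * rowOp q x y (fun _ => 0) Y row n)
      (rowOp q x y (fun _ => 0) Y row n * rowOp q x u v U row n) := by
  -- The outer sliding step runs over the `Y`-lines. Its local exchange is the inner step, which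
  -- carries one crossing of a `Y`-line with the row past all `U`-lines by the Yang-Baxter equation.
  have key := prod_mul_mul_reverse_prod_of_exchange
    (fun i => ((colList n).map fun j => crossing (weightD q (y i) (u j) (v j)) (U j) (Y i)).prod)
    (fun i => crossing (weightG q x (y i) 0) (Y i) row) (rowOp q x u v U row n)
    (colList n).reverse (List.nodup_reverse.2 (nodup_colList n)) (fun i hi => ?_)
    (fun i i' hii' => ?_)
  · rw [List.reverse_reverse] at key
    rw [SemiconjBy, ← mul_assoc]
    exact key
  · have hi' := mem_colList.1 (List.mem_reverse.1 hi)
    exact prod_mul_prod_mul_of_exchange _ _ _ _ (nodup_colList n)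
      (fun j _ => yangBaxter hq (u j) (v j) hx (hy i hi'.1 hi'.2) (hUY j i) (hUr j) (hYr i))
      (fun j j' hjj' => crossing_comm _ _ (hU.ne hjj') (hUr j) (hUY j' i).symm (hYr i))
  · refine Commute.list_prod_left _ _ fun z hz => ?_
    obtain ⟨j, -, rfl⟩ := List.mem_map.1 hz
    exact crossing_comm _ _ (hUY j i') (hUr j) (hY.ne hii') (hYr i)

/-- By conservation the two outgoing labels vanish only if the incoming ones do, and the empty
vertex has weight `1`. -/
theorem crossing_emptyInd (w : ℕ → ℕ → ℕ → ℕ → K) (hw : w 0 0 0 0 = 1) (c : ℕ → ι) (N : ℕ)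
    {i j : ℕ} (hij : c i ≠ c j) (hi : 1 ≤ i ∧ i ≤ N) (hj : 1 ≤ j ∧ j ≤ N) :
    crossing w (c i) (c j) (emptyInd K c N) = emptyInd K c N := by
  funext σ
  by_cases h : σ (c i) = 0 ∧ σ (c j) = 0
  · exact crossing_apply_of_zero w hw _ h.1 h.2
  · have h1 : emptyInd K c N σ = 0 := if_neg fun h' => h ⟨h' i hi.1 hi.2, h' j hj.1 hj.2⟩
    rw [h1, crossing_apply]
    refine Finset.sum_eq_zero fun p hp => ?_
    have hp' := Finset.HasAntidiagonal.mem_antidiagonal.1 hp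
    rw [emptyInd, if_neg, mul_zero]
    intro h'
    have h2 := h' i hi.1 hi.2
    have h3 := h' j hj.1 hj.2
    rw [setState_left hij] at h2
    rw [setState_right] at h3
    omega

theorem list_prod_apply_of_forall {V : Type*} [AddCommGroup V] [Module K V]
    (L : List (Module.End K V)) (f : V) (h : ∀ T ∈ L, T f = f) : L.prod f = f := by
  induction L with
  | nil => rfl
  | cons T L ih =>
    rw [List.prod_cons, Module.End.mul_apply, ih fun U hU => h U (List.mem_cons_of_mem T hU),
      h T List.mem_cons_self]

theorem gridD_emptyInd {q : K} (hq : ∀ k : ℕ, 0 < k → q ^ k ≠ 1) (u v y : ℕ → K) (n : ℕ)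
    {U Y : ℕ → ι} (hUY : ∀ i j, U i ≠ Y j) :
    gridD q u v y U Y n (emptyInd K (joinCols U Y n) (n + n))
      = emptyInd K (joinCols U Y n) (n + n) := by
  refine list_prod_apply_of_forall _ _ fun T hT => ?_
  obtain ⟨i, hi, rfl⟩ := List.mem_map.1 hT
  refine list_prod_apply_of_forall _ _ fun T hT => ?_
  obtain ⟨j, hj, rfl⟩ := List.mem_map.1 hT
  have hi' := mem_colList.1 (List.mem_reverse.1 hi)
  have hj' := mem_colList.1 hj
  have e1 : U j = joinCols U Y n (n + j) := by
    rw [joinCols, if_neg (by omega), Nat.add_sub_cancel_left]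
  have e2 : Y i = joinCols U Y n i := by rw [joinCols, if_pos hi'.2]
  rw [e1, e2]
  refine crossing_emptyInd _ (weightD_zero hq _ _ _) _ _ ?_ (by omega) (by omega)
  rw [← e1, ← e2]
  exact hUY j i

/-- Views both blocks as one lattice whose `n` rightmost columns have `v = 0`, the form to which
`rows_apply_eq_zero` applies. -/
theorem rowOp_mul_rowOp (q x : K) (u v y : ℕ → K) (U Y : ℕ → ι) (row : ι) (n : ℕ) :
    rowOp q x u v U row n * rowOp q x y (fun _ => 0) Y row n
      = rowOp q x (fun i => if i ≤ n then y i else u (i - n))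
        (fun i => if i ≤ n then 0 else v (i - n)) (joinCols U Y n) row (n + n) := by
  rw [rowOp, rowOp, rowOp, colList_add, List.map_append, List.prod_append, List.map_map]
  congr 2
  · refine List.map_congr_left fun i hi => ?_
    have hi' := mem_colList.1 hi
    simp [joinCols, show ¬ n + i ≤ n by omega]
  · refine List.map_congr_left fun i hi => ?_
    have hi' := mem_colList.1 hi
    simp [joinCols, hi'.2]

/-- The rows crossing the columns `U n, …, U 1` and then `Y n, …, Y 1`, with empty exits of all
columns. -/
theorem joined_rows_apply {q : K} (hq : ∀ k : ℕ, 0 < k → q ^ k ≠ 1) (u v y : ℕ → K) {n : ℕ}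
    (x : Fin n → K) {U Y : ℕ → ι} {row : Fin n → ι} (hU : Function.Injective U)
    (hY : Function.Injective Y) (hrow : Function.Injective row) (hUY : ∀ i j, U i ≠ Y j)
    (hUr : ∀ i k, U i ≠ row k) (hYr : ∀ i k, Y i ≠ row k) {σ : ι → ℕ} (hσ : ∀ k, σ (row k) = 0) :
    ((List.finRange n).map fun k => rowOp q (x k.rev) u v U (row k) n *
        rowOp q (x k.rev) y (fun _ => 0) Y (row k) n).prod
        (emptyInd K (joinCols U Y n) (n + n)) σ
      = emptyInd K U n σ *
        polyG q y (fun _ => 0) (partitionOfColMult fun i : Fin n => σ (Y (i + 1))) x := by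
  -- If the `U`-columns are empty they drop out and the `Y`-columns give the polynomial. Otherwise a
  -- particle starts left of `n` columns with `v = 0` and cannot leave in `n` rows.
  by_cases h : ∀ i, 1 ≤ i → i ≤ n → σ (U i) = 0
  · rw [emptyInd, if_pos h, one_mul, polyG_eq_rows hq y _ _ x hY hrow hYr
      (colLen_partitionOfColMult _) (σ := σ) (fun i h1 h2 => ?_) hσ]
    · refine rows_drop_empty hq (fun k : Fin n => x k.rev) u v y _ (fun i j _ _ => hUY i j) hrow
        hUr hYr _ (List.nodup_finRange n) _ _ (fun σ' h' => ?_) h hσ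
      rw [emptyInd_joinCols, emptyInd, if_pos h', one_mul]
    · have := colMult_partitionOfColMult (fun i : Fin n => σ (Y (i + 1))) ⟨i - 1, by omega⟩
      simp only [Nat.sub_add_cancel h1] at this
      exact this.symm
  · rw [emptyInd, if_neg h, zero_mul]
    push Not at h
    obtain ⟨i, h1, h2, h3⟩ := h
    simp only [rowOp_mul_rowOp]
    refine rows_apply_eq_zero (n := n) q (fun k : Fin n => x k.rev) _ _
      (joinCols_injective hU hY hUY n) (fun i k => ?_) (fun i hi => if_pos hi) _ (by simp) σ
      ⟨n + i, by simp; omega, by omega, ?_⟩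
    · rw [joinCols]
      split_ifs
      · exact hYr _ _
      · exact hUr _ _
    · rwa [joinCols, if_neg (by omega), Nat.add_sub_cancel_left]

open Classical in
theorem coeffD_eq_sum (q : K) (u v y : ℕ → K) (n : ℕ) (lam mu : YoungDiagram) :
    coeffD q u v y n lam mu
      = ∑ C ∈ gridCfgs n (fun j : Fin n => colMult lam (n - j)) (fun _ : Fin n => 0),
        cfgWeight (fun i j : Fin n => weightD q (y (i + 1)) (u (n - j)) (v (n - j))) C *
          if C.vert (Fin.last n) = 0 ∧
            (fun i => C.horiz i (Fin.last n)) = fun i : Fin n => colMult mu (i + 1)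
          then 1 else 0 := by
  rw [coeffD, partitionFunction_eq_sum]
  refine Finset.sum_congr rfl fun C _ => ?_
  simp only [Set.mem_singleton_iff]

open Classical in
/-- The expansion of `polyG` as a sum over the configurations of the coefficient lattice. -/
theorem polyG_eq_sum_gridCfgs {q : K} (hq : ∀ k : ℕ, 0 < k → q ^ k ≠ 1) (n : ℕ)
    (u v y : ℕ → K) (hy : ∀ i : ℕ, 1 ≤ i → i ≤ n → y i ≠ 0) (lam : YoungDiagram)
    (hlam : lam.colLen 0 ≤ n) (x : Fin n → K) (hx : ∀ i, x i ≠ 0) :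
    polyG q u v lam x
      = ∑ C ∈ gridCfgs n (fun j : Fin n => colMult lam (n - j)) (fun _ : Fin n => 0),
        cfgWeight (fun i j : Fin n => weightD q (y (i + 1)) (u (n - j)) (v (n - j))) C *
          if C.vert (Fin.last n) = 0 then
            polyG q y (fun _ => 0) (partitionOfColMult fun i => C.horiz i (Fin.last n)) x
          else 0 := by
  let U : ℕ → Fin 3 × ℕ := fun i => (0, i)
  let Y : ℕ → Fin 3 × ℕ := fun i => (1, i)
  let row : Fin n → Fin 3 × ℕ := fun k => (2, k)
  have hU : Function.Injective U := fun a b e => (Prod.ext_iff.1 e).2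
  have hY : Function.Injective Y := fun a b e => (Prod.ext_iff.1 e).2
  have hrow : Function.Injective row := fun a b e => Fin.ext (Prod.ext_iff.1 e).2
  have hUY : ∀ i j, U i ≠ Y j := fun i k e => by simpa [U, Y] using (Prod.ext_iff.1 e).1
  have hUr : ∀ i j, U i ≠ row j := fun i k e => by simpa [U, row] using (Prod.ext_iff.1 e).1
  have hYr : ∀ i j, Y i ≠ row j := fun i k e => by simpa [Y, row] using (Prod.ext_iff.1 e).1
  let σ : Fin 3 × ℕ → ℕ := fun l => if l.1 = 0 then colMult lam l.2 else 0
  have hσU : ∀ i, σ (U i) = colMult lam i := fun i => by simp [σ, U]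
  have hσY : ∀ i, σ (Y i) = 0 := fun i => by simp [σ, Y]
  have hσr : ∀ k, σ (row k) = 0 := fun k => by simp [σ, row]
  have hcomm := semiconjBy_list_prod (gridD q u v y U Y n)
    (fun k : Fin n => rowOp q (x k.rev) u v U (row k) n *
      rowOp q (x k.rev) y (fun _ => 0) Y (row k) n)
    (fun k : Fin n => rowOp q (x k.rev) y (fun _ => 0) Y (row k) n *
      rowOp q (x k.rev) u v U (row k) n) (List.finRange n)
    (fun k _ => gridD_semiconjBy hq u v y n hy hU hY hUY (hx k.rev) (fun i => hUr i k)
      (fun i => hYr i k))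
  -- Both orders of grid and rows are evaluated at the state with the columns of `lam` on the
  -- `U`-lines and all other lines empty.
  have happ := congrFun (LinearMap.congr_fun hcomm.eq (emptyInd K (joinCols U Y n) (n + n))) σ
  simp only [Module.End.mul_apply] at happ
  rw [gridD_emptyInd hq u v y n hUY] at happ
  have hR : ((List.finRange n).map fun k : Fin n => rowOp q (x k.rev) y (fun _ => 0) Y (row k) n *
      rowOp q (x k.rev) u v U (row k) n).prod (emptyInd K (joinCols U Y n) (n + n)) σ
      = polyG q u v lam x := by
    rw [polyG_eq_rows hq u v lam x hU hrow hUr hlam (σ := σ) (fun i _ _ => hσU i) hσr]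
    refine rows_drop_empty hq (fun k : Fin n => x k.rev) y _ u v (fun i j _ _ => (hUY j i).symm)
      hrow hYr hUr _ (List.nodup_finRange n) _ _ (fun σ' h' => ?_) (fun i _ _ => hσY i) hσr
    rw [emptyInd_joinCols, mul_comm, emptyInd, if_pos h', one_mul]
  rw [← hR, ← happ]
  have hgrid : gridD q u v y U Y n = (List.ofFn fun i : Fin n => (List.ofFn fun j : Fin n =>
      crossing (weightD q (y (i + 1)) (u (n - j)) (v (n - j))) (U (n - j)) (Y (i + 1))).prod).prod
      := by
    rw [gridD, ← ofFn_succ_eq_map_colList_reverse (fun i => ((colList n).map fun j =>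
      crossing (weightD q (y i) (u j) (v j)) (U j) (Y i)).prod)]
    congr 2
    funext i
    rw [← ofFn_sub_eq_map_colList
      (fun j => crossing (weightD q (y (i + 1)) (u j) (v j)) (U j) (Y (i + 1)))]
  rw [hgrid, grid_prod_apply (fun i j : Fin n => weightD q (y (i + 1)) (u (n - j)) (v (n - j)))
    (fun j => U (n - j)) (fun i => Y (i + 1)) (fun j j' e => ?_) (fun i i' e => ?_)
    (fun i j => hUY _ _) _ (fun top right => if top = 0 then
      polyG q y (fun _ => 0) (partitionOfColMult right) x else 0) σ (fun σ' hσ' => ?_)]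
  · have e1 : (σ ∘ fun j : Fin n => U (n - j)) = fun j : Fin n => colMult lam (n - j) :=
      funext fun j => hσU _
    have e2 : (σ ∘ fun i : Fin n => Y (i + 1)) = fun _ => 0 := funext fun i => hσY (i + 1)
    rw [e1, e2]
  · have := hU e
    exact Fin.ext (by omega)
  · have := hY e
    exact Fin.ext (by omega)
  · rw [joined_rows_apply hq u v y x hU hY hrow hUY hUr hYr fun k => ?_]
    · rw [emptyInd, ite_mul, one_mul, zero_mul]
      congr 1
      refine propext ⟨fun h => funext fun j => h _ (by omega) (by omega), fun h i h1 h2 => ?_⟩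
      have := congrFun h ⟨n - i, by omega⟩
      simpa [Nat.sub_sub_self h2] using this
    · rw [hσ' _ (fun j => (hUr _ _).symm) (fun i => (hYr _ _).symm), hσr]

end Expansion

end QLattice

theorem mainTheorem2 {K : Type*} [Field K] (q : K) (hq : ∀ k : ℕ, 0 < k → q ^ k ≠ 1)
    (n : ℕ) (hn : 0 < n) (u v y : ℕ → K) (hy : ∀ i : ℕ, 1 ≤ i → i ≤ n → y i ≠ 0)
    (lam : YoungDiagram) (hlam : lam.colLen 0 ≤ n)
    (x : Fin n → K) (hx : ∀ i, x i ≠ 0) :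
    (Function.support fun mu : YoungDiagram =>
        QLattice.coeffD q u v y n lam mu * QLattice.polyG q y (fun _ => 0) mu x).Finite ∧
      QLattice.polyG q u v lam x
        = ∑ᶠ mu : YoungDiagram,
            QLattice.coeffD q u v y n lam mu * QLattice.polyG q y (fun _ => 0) mu x := by
  classical
  open QLattice in
  set S := gridCfgs n (fun j : Fin n => colMult lam (n - j)) (fun _ : Fin n => 0) with hS
  let p : Labelling n n → YoungDiagram := fun C =>
    partitionOfColMult fun i => C.horiz i (Fin.last n)
  have hsupp : (Function.support fun mu : YoungDiagram =>
      coeffD q u v y n lam mu * polyG q y (fun _ => 0) mu x) ⊆ ↑(S.image p) := by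
    intro mu hmu
    -- `coeffD` does not see columns of `mu` longer than `n`, so infinitely many `mu` can share a
    -- nonzero coefficient. The vanishing of `polyG` makes the support finite.
    have h1 : mu.colLen 0 ≤ n := by
      by_contra h
      exact right_ne_zero_of_mul hmu (polyG_eq_zero_of_lt q y x (by omega))
    have h2 := left_ne_zero_of_mul hmu
    rw [coeffD_eq_sum] at h2
    obtain ⟨C, hC, h3⟩ := Finset.exists_ne_zero_of_sum_ne_zero h2
    have h4 := right_ne_zero_of_mul h3
    rw [ne_eq, ite_eq_right_iff, Classical.not_imp] at h4
    refine Finset.mem_coe.2 (Finset.mem_image.2 ⟨C, hC, ?_⟩)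
    rw [eq_partitionOfColMult h1, ← h4.1.2]
  refine ⟨(Finset.finite_toSet _).subset hsupp, ?_⟩
  rw [finsum_eq_sum_of_support_subset _ hsupp, polyG_eq_sum_gridCfgs hq n u v y hy lam hlam x hx]
  simp only [coeffD_eq_sum, Finset.sum_mul]
  rw [Finset.sum_comm]
  refine Finset.sum_congr rfl fun C hC => ?_
  -- A configuration contributes to exactly one partition of the image, the one read off from its
  -- right labels.
  rw [Finset.sum_eq_single (p C)]
  · have : (fun i => C.horiz i (Fin.last n)) = fun i : Fin n => colMult (p C) (i + 1) :=
      funext fun i => (colMult_partitionOfColMult (fun i => C.horiz i (Fin.last n)) i).symm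
    rw [mul_assoc, ite_mul, one_mul, zero_mul]
    simp only [this.symm, and_true, p]
  · intro mu hmu hne
    rw [if_neg, mul_zero, zero_mul]
    rintro ⟨-, h⟩
    obtain ⟨C', -, rfl⟩ := Finset.mem_image.1 hmu
    apply hne
    have h1 : (p C').colLen 0 ≤ n := colLen_partitionOfColMult _
    rw [eq_partitionOfColMult h1, ← h]
  · intro h
    exact absurd (Finset.mem_image_of_mem p hC) h
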